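/- Conventions. C*-algebras are unital. $*$ denotes the full unital free product (amalgamated over $\mathbb C1$) for C*-algebras, and the free product for groups. $C^*(\Gamma)$ is the full group C*-algebra of a discrete group $\Gamma$, with its standard Hopf algebra structure on the dense subalgebra $\mathbb C[\Gamma]$: $\Delta(g)=g\otimes g$, $\varepsilon(g)=1$, $S(g)=g^{-1}$ for $g\in\Gamma$. If $A$ is a C*-algebra and $u\in M_n(A)$, the free complexification of $(A,u)$ is the pair $(\tilde A,\tilde u)$, where $\tilde u=zu$, with $z\in C(\mathbb T)$ the identity function $z(x)=x$, and $\tilde A\subset C(\mathbb T)*A$ is the C*-subalgebra generated by the entries of $\tilde u$. Theorem. Let $n\ge 1$, let $G\subset U_n$ be a compact abelian subgroup, and let $u=(u_{ij})\in M_n(C(G))$, $u_{ij}(g)=g_{ij}$, be the matrix of coordinate functions. Let $L$ be the image of $G$ in $PU_n=U_n/\mathbb T$, let $\widehat L$ be its Pontryagin dual, regarded as a discrete group, and let $\Gamma=\mathbb Z*\widehat L$. Then the free complexification $(\tilde C(G),\tilde u)$ of $(C(G),u)$ is isomorphic to $C^*(\Gamma)$, as a C*-algebra and compatibly with the Hopf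 algebra structures. That is, there are a matrix $w\in M_n(\mathbb C[\Gamma])$, unitary over $C^*(\Gamma)$, whose entries generate $C^*(\Gamma)$ and satisfy $$\Delta(w_{ij})=\sum_k w_{ik}\otimes w_{kj},\qquad \varepsilon(w_{ij})=\delta_{ij},\qquad S(w_{ij})=w_{ji}^*,$$ and a $*$-isomorphism $\Phi:\tilde C(G)\to C^*(\Gamma)$ such that $\Phi(\tilde u_{ij})=w_{ij}$ for all $i,j$. -/

import Mathlib

open scoped ENNReal TensorProduct

universe u

noncomputable section

/-- The `ℓ^∞`-product of a family of nonzero unital C⋆-algebras is a unital C⋆-algebra. -/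
instance lpInftyCStarAlgebra {I : Type*} {A : I → Type*} [∀ i, Nontrivial (A i)]
    [∀ i, CStarAlgebra (A i)] : CStarAlgebra (lp A ∞) where

/-! ### The full group C⋆-algebra `C⋆(Γ)` of a discrete group -/

/-- A unitary representation of the (discrete) group `Γ` in a nonzero unital C⋆-algebra. -/
structure UnitaryRep (Γ : Type u) [Group Γ] where
  carrier : Type u
  [cstar : CStarAlgebra carrier]
  [nontrivial : Nontrivial carrier]
  hom : Γ →* unitary carrier

attribute [instance] UnitaryRep.cstar UnitaryRep.nontrivial

/-- The `ℓ^∞`-product of all unitary representations of `Γ : Type u` in C⋆-algebras in `Type u`.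
Each C⋆-algebra generated by a unitary representation of `Γ` has a copy in `Type u`. -/
abbrev GroupCStarAmbient (Γ : Type u) [Group Γ] : Type (u + 1) :=
  lp (fun π : UnitaryRep Γ => π.carrier) ∞

/-- The canonical unitary of `g ∈ Γ`: the family `(π(g))_π`, with `π` running over all unitary
representations. -/
def groupCStarGen {Γ : Type u} [Group Γ] (g : Γ) : GroupCStarAmbient Γ :=
  ⟨fun π => (π.hom g : π.carrier), memℓp_infty ⟨1, by
    rintro _ ⟨π, rfl⟩
    exact (CStarRing.norm_coe_unitary (π.hom g)).le⟩⟩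

/-- The full group C⋆-algebra as a subalgebra of the product of all representations: the
C⋆-algebra generated by the canonical unitaries, i.e. the completion of `ℂ[Γ]` in the norm
`‖x‖ = sup_π ‖π(x)‖`. -/
def groupCStarSubalgebra (Γ : Type u) [Group Γ] : StarSubalgebra ℂ (GroupCStarAmbient Γ) :=
  (StarAlgebra.adjoin ℂ (Set.range (groupCStarGen (Γ := Γ)))).topologicalClosure

/-- The full group C⋆-algebra `C⋆(Γ)` of the discrete group `Γ`. -/
abbrev GroupCStar (Γ : Type u) [Group Γ] : Type (u + 1) := groupCStarSubalgebra Γ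

instance groupCStarAlgebra (Γ : Type u) [Group Γ] : CStarAlgebra (GroupCStar Γ) :=
  StarSubalgebra.cstarAlgebra _
    (h_closed := StarSubalgebra.isClosed_topologicalClosure _)

/-- The canonical homomorphism of `Γ` into the multiplicative monoid of `C⋆(Γ)`. -/
def groupCStarOf (Γ : Type u) [Group Γ] : Γ →* GroupCStar Γ where
  toFun g := ⟨groupCStarGen g, StarSubalgebra.le_topologicalClosure _
    (StarAlgebra.subset_adjoin ℂ _ ⟨g, rfl⟩)⟩
  map_one' := by
    apply Subtype.ext
    apply lp.ext
    funext π
    simp [groupCStarGen]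
  map_mul' g h := by
    apply Subtype.ext
    apply lp.ext
    funext π
    simp [groupCStarGen]

/-- The canonical homomorphism `ℂ[Γ] → C⋆(Γ)`, through which `ℂ[Γ]` is the standard dense
subalgebra of `C⋆(Γ)`. -/
def groupAlgebraToCStar (Γ : Type u) [Group Γ] : MonoidAlgebra ℂ Γ →ₐ[ℂ] GroupCStar Γ :=
  MonoidAlgebra.lift ℂ (GroupCStar Γ) Γ (groupCStarOf Γ)

/-! ### The full free product `A * B` of unital C⋆-algebras (amalgamated over `ℂ 1`) -/

/-- A pair of unital `*`-homomorphisms of `A` and `B` into one nonzero unital C⋆-algebra. -/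
structure PairRep (A B : Type u) [CStarAlgebra A] [CStarAlgebra B] where
  carrier : Type u
  [cstar : CStarAlgebra carrier]
  [nontrivial : Nontrivial carrier]
  left : A →⋆ₐ[ℂ] carrier
  right : B →⋆ₐ[ℂ] carrier

attribute [instance] PairRep.cstar PairRep.nontrivial

/-- The `ℓ^∞`-product of all pairs of representations of `A, B : Type u` in a C⋆-algebra in
`Type u`. Each C⋆-algebra generated by such a pair has a copy in `Type u`. -/
abbrev FreeProdAmbient (A B : Type u) [CStarAlgebra A] [CStarAlgebra B] : Type (u + 1) :=
  lp (fun π : PairRep A B => π.carrier) ∞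

/-- The element `a ∈ A` seen in the free product: the family `(π(a))_π`. -/
def freeProdLeft {A B : Type u} [CStarAlgebra A] [CStarAlgebra B] (a : A) :
    FreeProdAmbient A B :=
  ⟨fun π => π.left a, memℓp_infty ⟨‖a‖, by
    rintro _ ⟨π, rfl⟩
    exact NonUnitalStarAlgHom.norm_apply_le π.left a⟩⟩

/-- The element `b ∈ B` seen in the free product: the family `(π(b))_π`. -/
def freeProdRight {A B : Type u} [CStarAlgebra A] [CStarAlgebra B] (b : B) :
    FreeProdAmbient A B :=
  ⟨fun π => π.right b, memℓp_infty ⟨‖b‖, by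
    rintro _ ⟨π, rfl⟩
    exact NonUnitalStarAlgHom.norm_apply_le π.right b⟩⟩

/-- The full free product as a subalgebra of the product of all pairs of representations: the
C⋆-algebra generated by the images of `A` and `B`, i.e. the completion of the algebraic unital
free product in its universal C⋆-norm. -/
def freeProdSubalgebra (A B : Type u) [CStarAlgebra A] [CStarAlgebra B] :
    StarSubalgebra ℂ (FreeProdAmbient A B) :=
  (StarAlgebra.adjoin ℂ (Set.range (freeProdLeft (A := A) (B := B)) ∪
    Set.range (freeProdRight (A := A) (B := B)))).topologicalClosure

/-- The full unital free product C⋆-algebra `A * B`. -/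
abbrev FreeProd (A B : Type u) [CStarAlgebra A] [CStarAlgebra B] : Type (u + 1) :=
  freeProdSubalgebra A B

instance freeProdCStarAlgebra (A B : Type u) [CStarAlgebra A] [CStarAlgebra B] :
    CStarAlgebra (FreeProd A B) :=
  StarSubalgebra.cstarAlgebra _
    (h_closed := StarSubalgebra.isClosed_topologicalClosure _)

/-- The canonical map `A → A * B`. -/
def FreeProd.inl {A B : Type u} [CStarAlgebra A] [CStarAlgebra B] (a : A) : FreeProd A B :=
  ⟨freeProdLeft a, StarSubalgebra.le_topologicalClosure _
    (StarAlgebra.subset_adjoin ℂ _ (Or.inl ⟨a, rfl⟩))⟩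

/-- The canonical map `B → A * B`. -/
def FreeProd.inr {A B : Type u} [CStarAlgebra A] [CStarAlgebra B] (b : B) : FreeProd A B :=
  ⟨freeProdRight b, StarSubalgebra.le_topologicalClosure _
    (StarAlgebra.subset_adjoin ℂ _ (Or.inr ⟨b, rfl⟩))⟩

/-! ### Free complexification -/

/-- The identity function `z : 𝕋 → ℂ`, as an element of `C(𝕋)`. -/
def circleId : C(Circle, ℂ) := ⟨fun x => (x : ℂ), continuous_subtype_val⟩

/-- The matrix `ũ = z u` over `C(𝕋) * A`. -/
def complexifiedMatrix {n : ℕ} {A : Type} [CStarAlgebra A] (u : Matrix (Fin n) (Fin n) A) :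
    Matrix (Fin n) (Fin n) (FreeProd C(Circle, ℂ) A) :=
  fun i j => FreeProd.inl circleId * FreeProd.inr (u i j)

/-- The free complexification `Ã ⊆ C(𝕋) * A` of `(A, u)`: the C⋆-algebra generated by the entries
of `ũ = z u`. -/
def freeComplexification {n : ℕ} {A : Type} [CStarAlgebra A] (u : Matrix (Fin n) (Fin n) A) :
    StarSubalgebra ℂ (FreeProd C(Circle, ℂ) A) :=
  (StarAlgebra.adjoin ℂ {x | ∃ i j, x = complexifiedMatrix u i j}).topologicalClosure

/-- The entries of `ũ`, as elements of `Ã`. -/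
def complexifiedEntry {n : ℕ} {A : Type} [CStarAlgebra A] (u : Matrix (Fin n) (Fin n) A)
    (i j : Fin n) : freeComplexification u :=
  ⟨complexifiedMatrix u i j, StarSubalgebra.le_topologicalClosure _
    (StarAlgebra.subset_adjoin ℂ _ ⟨i, j, rfl⟩)⟩

/-! ### Subgroups of `U_n` and of `PU_n` -/

/-- The matrix of coordinate functions `u_{ij}(g) = g_{ij}` in `M_n(C(G))`, for `G ⊆ U_n`. -/
def coordinateMatrix {n : ℕ} (G : Subgroup (Matrix.unitaryGroup (Fin n) ℂ)) :
    Matrix (Fin n) (Fin n) C(G, ℂ) :=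
  fun i j => ⟨fun g => (g : Matrix.unitaryGroup (Fin n) ℂ).1 i j,
    (continuous_subtype_val.comp continuous_subtype_val).matrix_elem i j⟩

/-- The subgroup of scalar matrices in `U_n`. -/
def scalarUnitary (n : ℕ) : Subgroup (Matrix.unitaryGroup (Fin n) ℂ) where
  carrier := {g | ∃ c : Circle, (g : Matrix (Fin n) (Fin n) ℂ) = (c : ℂ) • 1}
  one_mem' := ⟨1, by simp⟩
  mul_mem' := by
    rintro a b ⟨c, hc⟩ ⟨d, hd⟩
    exact ⟨c * d, by simp [hc, hd, smul_smul, mul_comm]⟩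
  inv_mem' := by
    rintro a ⟨c, hc⟩
    refine ⟨c⁻¹, ?_⟩
    change star (a : Matrix (Fin n) (Fin n) ℂ) = ((c⁻¹ : Circle) : ℂ) • 1
    rw [hc, Circle.coe_inv_eq_conj, star_smul, star_one]
    rfl

instance scalarUnitary_normal (n : ℕ) : (scalarUnitary n).Normal where
  conj_mem := by
    rintro a ⟨c, hc⟩ g
    refine ⟨c, ?_⟩
    have h : (g : Matrix (Fin n) (Fin n) ℂ) * ((g⁻¹ : Matrix.unitaryGroup (Fin n) ℂ) :
        Matrix (Fin n) (Fin n) ℂ) = 1 := by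
      rw [← Submonoid.coe_mul, mul_inv_cancel, Submonoid.coe_one]
    rw [Submonoid.coe_mul, Submonoid.coe_mul, hc]
    rw [mul_smul_comm, mul_one, smul_mul_assoc, h]

/-- The projective unitary group `PU_n = U_n / 𝕋`, with the quotient topology. -/
abbrev ProjectiveUnitaryGroup (n : ℕ) : Type :=
  Matrix.unitaryGroup (Fin n) ℂ ⧸ scalarUnitary n

/-- The image of `G ⊆ U_n` in `PU_n`. -/
def projectiveImage {n : ℕ} (G : Subgroup (Matrix.unitaryGroup (Fin n) ℂ)) :
    Subgroup (ProjectiveUnitaryGroup n) :=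
  G.map (QuotientGroup.mk' (scalarUnitary n))

/-- The group `ℤ * L̂`, with `L̂` the Pontryagin dual of the image `L` of `G` in `PU_n`. -/
abbrev FreeDualGroup {n : ℕ} (G : Subgroup (Matrix.unitaryGroup (Fin n) ℂ)) : Type :=
  Monoid.Coprod (Multiplicative ℤ) (PontryaginDual (projectiveImage G))

/-! ### The Hopf algebra structure of `C⋆(Γ)` -/

/-- The matrix `w`, with entries in `ℂ[Γ] ⊆ C⋆(Γ)`, makes `C⋆(Γ)` with its standard
comultiplication `g ↦ g ⊗ g`, counit `g ↦ 1` and antipode `g ↦ g⁻¹` a finitely generated Hopf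
algebra: `w` is unitary, its entries generate `C⋆(Γ)`, and `Δ(w_{ij}) = ∑ w_{ik} ⊗ w_{kj}`,
`ε(w_{ij}) = δ_{ij}`, `S(w_{ij}) = w_{ji}^*`. -/
structure IsFundamentalMatrix {n : ℕ} {Γ : Type} [Group Γ]
    (w : Matrix (Fin n) (Fin n) (MonoidAlgebra ℂ Γ)) : Prop where
  unitary_mem : w.map (groupAlgebraToCStar Γ) ∈ unitary (Matrix (Fin n) (Fin n) (GroupCStar Γ))
  generates : (StarAlgebra.adjoin ℂ
    {x | ∃ i j, x = groupAlgebraToCStar Γ (w i j)}).topologicalClosure = ⊤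
  comul : ∀ i j, Coalgebra.comul (R := ℂ) (w i j) = ∑ k, w i k ⊗ₜ[ℂ] w k j
  counit : ∀ i j, Coalgebra.counit (R := ℂ) (w i j) = if i = j then 1 else 0
  antipode : ∀ i j, groupAlgebraToCStar Γ (HopfAlgebra.antipode ℂ (w i j)) =
    star (groupAlgebraToCStar Γ (w j i))

end

/-! Commuting unitary matrices are simultaneously diagonalisable, so g = Q diag(χ_p(g)) Q* on G,
with characters χ_p that separate points and hence generate Ĝ. Fix an index o. The quotients η_p =
χ_p χ_o⁻¹ are trivial on scalar matrices, so they are characters of L; they separate the points of L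
and therefore generate L̂. Composition with G → L embeds L̂ in Ĝ, and Ĝ is generated by L̂ and χ_o.

Let a be the generator of ℤ. The map C⋆(ℤ * L̂) → C(𝕋) * C(G) given by a ↦ zχ_o and h ↦ h sends a
η_p to zχ_p. It therefore carries w = Q diag(a η_p) Q* to ũ = zu, and the entries of w generate C⋆(ℤ
* L̂) because the a η_p generate the group. Only injectivity remains
(`groupCStarToFreeProd_injective`).

For this, every representation ρ of ℤ * L̂ has to be recovered from a pair of representations of
C(𝕋) and C(G). The restriction of ρ to L̂ extends to Ĝ in a larger algebra, since Ĝ is L̂ with one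
more generator, and unitaries acquire roots in matrix algebras (`exists_extension_unitaryRep`). The
extension σ factors through C(G), because trigonometric polynomials have norm at most the sup norm
in any unitary representation of Ĝ (`norm_lift_le_norm_lift_characterFun`). Sending z to ρ(a)
σ(χ_o)⁻¹ then gives zχ_o ↦ ρ(a). -/

noncomputable section

/-! ### Characters of compact groups -/

/-- A character of `K` as a continuous complex-valued function. -/
def characterFun (K : Type*) [Group K] [TopologicalSpace K] : PontryaginDual K →* C(K, ℂ) where
  toFun θ := ⟨fun x => (θ x : ℂ), continuous_subtype_val.comp (map_continuous θ)⟩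
  map_one' := by ext x; simp
  map_mul' θ η := by
    ext x
    change ((θ x * η x : Circle) : ℂ) = _
    simp

@[simp]
theorem characterFun_apply {K : Type*} [Group K] [TopologicalSpace K] (θ : PontryaginDual K)
    (x : K) : characterFun K θ x = (θ x : ℂ) := rfl

theorem PontryaginDual.mul_apply {K : Type*} [Group K] [TopologicalSpace K]
    (θ η : PontryaginDual K) (x : K) : (θ * η) x = θ x * η x := rfl

theorem PontryaginDual.inv_apply {K : Type*} [Group K] [TopologicalSpace K]
    (θ : PontryaginDual K) (x : K) : θ⁻¹ x = (θ x)⁻¹ := rfl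

theorem star_characterFun {K : Type*} [Group K] [TopologicalSpace K] [CompactSpace K]
    (θ : PontryaginDual K) : star (characterFun K θ) = characterFun K θ⁻¹ := by
  ext x
  rw [ContinuousMap.star_apply, characterFun_apply, characterFun_apply,
    PontryaginDual.inv_apply, Circle.coe_inv_eq_conj]
  rfl

/-- Integration against the Haar probability measure of a compact group. -/
theorem exists_haar_functional (K : Type*) [Group K] [TopologicalSpace K] [IsTopologicalGroup K]
    [CompactSpace K] : ∃ I : C(K, ℂ) →L[ℂ] ℂ, (∀ f, ‖I f‖ ≤ ‖f‖) ∧ I 1 = 1 ∧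
      ∀ θ : PontryaginDual K, θ ≠ 1 → I (characterFun K θ) = 0 := by
  let _ : MeasurableSpace K := borel K
  have : BorelSpace K := ⟨rfl⟩
  let μ : MeasureTheory.Measure K := MeasureTheory.Measure.haarMeasure ⊤
  have : MeasureTheory.IsProbabilityMeasure μ :=
    ⟨by
      simpa using MeasureTheory.Measure.haarMeasure_self
        (K₀ := (⊤ : TopologicalSpace.PositiveCompacts K))⟩
  have hint (f : C(K, ℂ)) : MeasureTheory.Integrable f μ :=
    f.continuous.integrable_of_hasCompactSupport (HasCompactSupport.of_compactSpace _)
  have hbd (f : C(K, ℂ)) : ‖∫ x, f x ∂μ‖ ≤ ‖f‖ := by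
    simpa using MeasureTheory.norm_integral_le_of_norm_le_const (μ := μ)
      (Filter.Eventually.of_forall fun x => f.norm_coe_le_norm x)
  let I₀ : C(K, ℂ) →ₗ[ℂ] ℂ :=
    { toFun := fun f => ∫ x, f x ∂μ
      map_add' := fun f g => MeasureTheory.integral_add (hint f) (hint g)
      map_smul' := fun c f => MeasureTheory.integral_const_mul c _ }
  refine ⟨I₀.mkContinuous 1 (fun f => (hbd f).trans_eq (one_mul _).symm), fun f => hbd f, ?_,
    fun θ hθ => ?_⟩
  · change ∫ x, (1 : C(K, ℂ)) x ∂μ = 1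
    simp
  · obtain ⟨y, hy⟩ : ∃ y, θ y ≠ 1 := by
      by_contra! h
      exact hθ (PontryaginDual.ext h)
    change ∫ x, (θ x : ℂ) ∂μ = 0
    -- Translation by y gives θ(y) ∫θ = ∫θ, while θ(y) ≠ 1.
    have h := MeasureTheory.integral_mul_left_eq_self (μ := μ) (fun x => (θ x : ℂ)) y
    simp only [map_mul, Circle.coe_mul, MeasureTheory.integral_const_mul] at h
    by_contra h0
    exact hy (Circle.ext (mul_right_cancel₀ h0 (by simpa using h)))

/-! ### Spans of groups of unitaries -/

theorem MonoidAlgebra.exists_lift_eq_star {Γ A : Type*} [Group Γ] [CStarAlgebra A] (φ : Γ →* A)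
    (hφ : ∀ g, star (φ g) = φ g⁻¹) (f : MonoidAlgebra ℂ Γ) :
    ∃ f', MonoidAlgebra.lift ℂ A Γ φ f' = star (MonoidAlgebra.lift ℂ A Γ φ f) := by
  induction f using MonoidAlgebra.induction_linear with
  | zero => exact ⟨0, by simp⟩
  | add f g hf hg =>
    obtain ⟨f', hf⟩ := hf
    obtain ⟨g', hg⟩ := hg
    exact ⟨f' + g', by simp [hf, hg]⟩
  | single g c => exact ⟨MonoidAlgebra.single g⁻¹ (star c), by simp [hφ]⟩

/-- The linear span of a group of unitaries is already closed under products and adjoints. -/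
theorem MonoidAlgebra.exists_lift_of_mem_adjoin {Γ A : Type*} [Group Γ] [CStarAlgebra A]
    (φ : Γ →* A) (hφ : ∀ g, star (φ g) = φ g⁻¹) {x : A}
    (hx : x ∈ StarAlgebra.adjoin ℂ (Set.range φ)) :
    ∃ f, MonoidAlgebra.lift ℂ A Γ φ f = x := by
  induction hx using StarAlgebra.adjoin_induction with
  | mem x h =>
    obtain ⟨g, rfl⟩ := h
    exact ⟨MonoidAlgebra.single g 1, by simp⟩
  | algebraMap r => exact ⟨algebraMap ℂ _ r, AlgHom.commutes _ r⟩
  | add x y _ _ hx hy =>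
    obtain ⟨f, rfl⟩ := hx
    obtain ⟨g, rfl⟩ := hy
    exact ⟨f + g, by simp⟩
  | mul x y _ _ hx hy =>
    obtain ⟨f, rfl⟩ := hx
    obtain ⟨g, rfl⟩ := hy
    exact ⟨f * g, by simp⟩
  | star x _ hx =>
    obtain ⟨f, rfl⟩ := hx
    exact MonoidAlgebra.exists_lift_eq_star φ hφ f

/-- This is Stone–Weierstrass. -/
theorem characterFun_separates_adjoin_closure {K : Type*} [Group K] [TopologicalSpace K]
    [CompactSpace K] (S : Set (PontryaginDual K))
    (hS : ∀ x y, (∀ θ ∈ S, θ x = θ y) → x = y) :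
    (StarAlgebra.adjoin ℂ (characterFun K '' S)).topologicalClosure = ⊤ := by
  apply ContinuousMap.starSubalgebra_topologicalClosure_eq_top_of_separatesPoints
  intro x y hxy
  by_contra! h
  refine hxy (hS x y fun θ hθ => Circle.ext ?_)
  exact h _ ⟨characterFun K θ, StarAlgebra.subset_adjoin ℂ _ ⟨θ, hθ, rfl⟩, rfl⟩

/-- A set of characters separating the points of a compact group generates its dual. -/
theorem dual_closure_eq_top_of_separates {K : Type*} [Group K] [TopologicalSpace K]
    [IsTopologicalGroup K] [CompactSpace K] (S : Set (PontryaginDual K))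
    (hS : ∀ x y, (∀ θ ∈ S, θ x = θ y) → x = y) : Subgroup.closure S = ⊤ := by
  obtain ⟨I, -, hI1, hI⟩ := exists_haar_functional K
  rw [Subgroup.eq_top_iff']
  intro θ
  by_contra hθ
  set H := Subgroup.closure S
  let φ : H →* C(K, ℂ) := (characterFun K).comp H.subtype
  have hφ (g : H) : star (φ g) = φ g⁻¹ := star_characterFun _
  have hdense := characterFun_separates_adjoin_closure S hS
  -- If θ lies outside `H`, the functional f ↦ I(f θ⁻¹) vanishes on the span of `H` by orthogonality
  -- of characters. That span is dense, yet the functional is 1 at θ.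
  have hclosed : IsClosed {f : C(K, ℂ) | I (f * characterFun K θ⁻¹) = 0} :=
    isClosed_eq (by fun_prop) continuous_const
  have hsub : (StarAlgebra.adjoin ℂ (characterFun K '' S) : Set C(K, ℂ)) ⊆
      {f : C(K, ℂ) | I (f * characterFun K θ⁻¹) = 0} := by
    intro f hf
    have hf' : f ∈ StarAlgebra.adjoin ℂ (Set.range φ) := by
      refine StarAlgebra.adjoin_mono ?_ hf
      rintro _ ⟨η, hη, rfl⟩
      exact ⟨⟨η, Subgroup.subset_closure hη⟩, rfl⟩
    obtain ⟨a, rfl⟩ := MonoidAlgebra.exists_lift_of_mem_adjoin φ hφ hf'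
    clear hf hf'
    change I _ = 0
    induction a using MonoidAlgebra.induction_linear with
    | zero => simp
    | add a b ha hb => rw [map_add, add_mul, map_add, ha, hb, add_zero]
    | single g c =>
      have hg : (g : PontryaginDual K) * θ⁻¹ ≠ 1 := fun h =>
        hθ (by rw [← mul_inv_eq_one.1 h]; exact g.2)
      have hφg : φ g = characterFun K g := rfl
      rw [MonoidAlgebra.lift_single, smul_mul_assoc, map_smul, hφg, ← map_mul, hI _ hg, smul_zero]
  have hθ' : characterFun K θ ∈ (StarAlgebra.adjoin ℂ (characterFun K '' S)).topologicalClosure :=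
    hdense ▸ StarSubalgebra.mem_top
  have h0 : I (characterFun K θ * characterFun K θ⁻¹) = 0 := closure_minimal hsub hclosed hθ'
  rw [← map_mul, mul_inv_cancel, map_one, hI1] at h0
  exact one_ne_zero h0

/-! ### Extending representations of the dual group to the algebra of continuous functions -/

/-- By commutativity, each element of the support of f ^ N is a monomial in the elements of the
support of f with exponents at most N. The growth in N is thus polynomial. -/
theorem MonoidAlgebra.card_support_pow_le {B : Type*} [CommMonoid B] (f : MonoidAlgebra ℂ B)
    (N : ℕ) : (f ^ N).coeff.support.card ≤ (N + 1) ^ f.coeff.support.card := by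
  classical
  set s := f.coeff.support with hs
  have key : ∀ N, ∀ b ∈ (f ^ N).coeff.support,
      ∃ e : s → ℕ, (∀ i, e i ≤ N) ∧ ∏ i : s, (i : B) ^ e i = b := by
    intro N
    induction N with
    | zero =>
      intro b hb
      refine ⟨0, fun _ => le_rfl, ?_⟩
      rw [pow_zero, MonoidAlgebra.one_def, MonoidAlgebra.coeff_single] at hb
      have := Finsupp.support_single_subset hb
      simpa using (Finset.mem_singleton.1 this).symm
    | succ N ih =>
      intro b hb
      rw [pow_succ] at hb
      obtain ⟨x, hx, y, hy, rfl⟩ :=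
        Finset.mem_mul.1 (MonoidAlgebra.support_coeff_mul_subset _ _ hb)
      obtain ⟨e, he, rfl⟩ := ih x hx
      refine ⟨e + Pi.single ⟨y, hy⟩ 1, fun i => ?_, ?_⟩
      · have h1 : (Pi.single (⟨y, hy⟩ : s) 1 : s → ℕ) i ≤ 1 := by
          by_cases h : i = ⟨y, hy⟩
          · subst h; simp
          · simp [h]
        exact Nat.add_le_add (he i) h1
      · simp only [Pi.add_apply, pow_add, Finset.prod_mul_distrib]
        congr 1
        rw [Finset.prod_eq_single (⟨y, hy⟩ : s)]
        · simp
        · intro i _ hi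
          simp [hi]
        · simp
  calc (f ^ N).coeff.support.card
      ≤ ((Fintype.piFinset fun _ : s => Finset.range (N + 1)).image
          fun e => ∏ i : s, (i : B) ^ e i).card := by
        refine Finset.card_le_card fun b hb => ?_
        obtain ⟨e, he, rfl⟩ := key N b hb
        exact Finset.mem_image_of_mem _
          (Fintype.mem_piFinset.2 fun i => Finset.mem_range.2 (Nat.lt_succ_of_le (he i)))
    _ ≤ _ := Finset.card_image_le
    _ = _ := by simp

/-- Taking N-th roots removes a polynomial factor. -/
theorem le_of_pow_le_poly_mul_pow {a b : ℝ} (ha : 0 ≤ a) (hb : 0 ≤ b) (d : ℕ)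
    (h : ∀ N : ℕ, a ^ N ≤ (N + 1) ^ d * b ^ N) : a ≤ b := by
  by_contra! hlt
  have ha' : 0 < a := hb.trans_lt hlt
  have h1 := tendsto_pow_const_mul_const_pow_of_lt_one d (div_nonneg hb ha) ((div_lt_one ha').2 hlt)
  -- If b < a then N ^ d (b / a) ^ N tends to 0. The bound N + 1 ≤ 2N, valid for N ≥ 1, keeps it
  -- above 2 ^ (-d).
  have h2 : ∀ N : ℕ, 1 ≤ N → (1 / 2 : ℝ) ^ d ≤ (N : ℝ) ^ d * (b / a) ^ N := by
    intro N hN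
    have h3 := h N
    have hN' : (1 : ℝ) ≤ N := by exact_mod_cast hN
    have h4 : ((N : ℝ) + 1) ^ d ≤ 2 ^ d * N ^ d := by
      rw [← mul_pow]
      gcongr
      linarith
    have h5 : a ^ N ≤ 2 ^ d * (N ^ d * b ^ N) := by
      calc a ^ N ≤ _ := h3
        _ ≤ 2 ^ d * N ^ d * b ^ N := by gcongr
        _ = _ := by ring
    rw [div_pow, div_pow, one_pow, ← mul_div_assoc, div_le_div_iff₀ (by positivity) (by positivity)]
    linarith
  have h6 := ge_of_tendsto h1 ((Filter.eventually_ge_atTop 1).mono h2)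
  have : (0 : ℝ) < (1 / 2) ^ d := by positivity
  linarith

/-- The norm of a normal element is its spectral radius, which is at most ‖x ^ N‖ ^ (1 / N) for N ≥
1. -/
theorem IsStarNormal.norm_pow_le {A : Type*} [CStarAlgebra A] [Nontrivial A] {x : A}
    (hx : IsStarNormal x) (N : ℕ) : ‖x‖ ^ N ≤ ‖x ^ N‖ := by
  obtain _ | N := N
  · simp
  have h := spectrum.spectralRadius_le_pow_nnnorm_pow_one_div ℂ x N
  rw [IsStarNormal.spectralRadius_eq_nnnorm, nnnorm_one, ENNReal.coe_one, ENNReal.one_rpow,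
    mul_one] at h
  have h' := ENNReal.rpow_le_rpow h (z := ((N + 1 : ℕ) : ℝ)) (by positivity)
  rw [← ENNReal.rpow_mul, Nat.cast_add_one, one_div_mul_cancel (by positivity), ENNReal.rpow_one,
    ← Nat.cast_add_one, ENNReal.rpow_natCast] at h'
  exact_mod_cast h'

/-- The coefficient at θ is the Fourier coefficient I(F θ⁻¹), and I is contractive. -/
theorem norm_coeff_le_norm_lift {K : Type*} [Group K] [TopologicalSpace K] [IsTopologicalGroup K]
    [CompactSpace K] (f : MonoidAlgebra ℂ (PontryaginDual K)) (θ : PontryaginDual K) :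
    ‖f.coeff θ‖ ≤ ‖MonoidAlgebra.lift ℂ C(K, ℂ) _ (characterFun K) f‖ := by
  obtain ⟨I, hIn, hI1, hI⟩ := exists_haar_functional K
  have key : f.coeff θ =
      I (MonoidAlgebra.lift ℂ C(K, ℂ) _ (characterFun K) f * characterFun K θ⁻¹) := by
    induction f using MonoidAlgebra.induction_linear with
    | zero => simp
    | add a b ha hb => rw [map_add, add_mul, map_add, ← ha, ← hb]; rfl
    | single g c =>
      rw [MonoidAlgebra.lift_single, smul_mul_assoc, map_smul, ← map_mul,
        MonoidAlgebra.coeff_single]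
      by_cases h : g = θ
      · subst h
        simp [hI1]
      · rw [hI _ (fun h' => h (mul_inv_eq_one.1 h')), Finsupp.single_eq_of_ne (Ne.symm h),
          smul_zero]
  have h1 : ‖characterFun K θ⁻¹‖ ≤ 1 :=
    (ContinuousMap.norm_le _ zero_le_one).2 fun x => (Circle.norm_coe _).le
  calc ‖f.coeff θ‖ ≤ _ := key ▸ hIn _
    _ ≤ _ := norm_mul_le _ _
    _ ≤ _ := mul_le_of_le_one_right (norm_nonneg _) h1

/-- Bounding each Fourier coefficient by the sup norm gives the inequality up to the factor |supp
f|. Applied to f ^ N, whose support grows polynomially, it loses this factor after N-th roots. The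
left side behaves well under powers because S f, in the image of a commutative *-algebra, is normal.
-/
theorem norm_lift_le_norm_lift_characterFun {K : Type*} [Group K] [TopologicalSpace K]
    [IsTopologicalGroup K] [CompactSpace K] {D : Type*} [CStarAlgebra D] [Nontrivial D]
    (σ : PontryaginDual K →* unitary D) (f : MonoidAlgebra ℂ (PontryaginDual K)) :
    ‖MonoidAlgebra.lift ℂ D _ ((unitary D).subtype.comp σ) f‖ ≤
      ‖MonoidAlgebra.lift ℂ C(K, ℂ) _ (characterFun K) f‖ := by
  set S := MonoidAlgebra.lift ℂ D _ ((unitary D).subtype.comp σ)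
  set F := MonoidAlgebra.lift ℂ C(K, ℂ) _ (characterFun K)
  have hl1 (g : MonoidAlgebra ℂ (PontryaginDual K)) :
      ‖S g‖ ≤ g.coeff.support.card * ‖F g‖ := by
    rw [MonoidAlgebra.lift_apply, ← nsmul_eq_mul, Finsupp.sum]
    refine (norm_sum_le _ _).trans (Finset.sum_le_card_nsmul _ _ _ fun θ _ => ?_)
    rw [norm_smul]
    exact (mul_le_of_le_one_right (norm_nonneg _) (CStarRing.norm_coe_unitary (σ θ)).le).trans
      (norm_coeff_le_norm_lift g θ)
  have hnormal : IsStarNormal (S f) := by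
    obtain ⟨f', hf'⟩ := MonoidAlgebra.exists_lift_eq_star ((unitary D).subtype.comp σ)
      (fun g => by simp [← Unitary.coe_star, Unitary.star_eq_inv]) f
    refine ⟨?_⟩
    change star (S f) * S f = S f * star (S f)
    rw [← hf', ← map_mul, ← map_mul, mul_comm]
  refine le_of_pow_le_poly_mul_pow (norm_nonneg _) (norm_nonneg _) f.coeff.support.card fun N => ?_
  calc ‖S f‖ ^ N ≤ ‖S f ^ N‖ := hnormal.norm_pow_le N
    _ = ‖S (f ^ N)‖ := by rw [map_pow]
    _ ≤ _ := hl1 _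
    _ ≤ (N + 1) ^ f.coeff.support.card * ‖F f‖ ^ N := by
      gcongr
      · exact_mod_cast f.card_support_pow_le N
      · rw [map_pow]
        exact norm_pow_le _ N

/-- A unitary representation of the dual of a compact group whose characters separate points
extends to the algebra of continuous functions. -/
theorem exists_starAlgHom_characterFun {K : Type*} [Group K] [TopologicalSpace K]
    [IsTopologicalGroup K] [CompactSpace K]
    (hK : ∀ x y : K, (∀ θ : PontryaginDual K, θ x = θ y) → x = y)
    {D : Type*} [CStarAlgebra D] [Nontrivial D] (σ : PontryaginDual K →* unitary D) :
    ∃ E : C(K, ℂ) →⋆ₐ[ℂ] D, ∀ θ, E (characterFun K θ) = σ θ := by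
  set S := MonoidAlgebra.lift ℂ D _ ((unitary D).subtype.comp σ) with hS
  set F := MonoidAlgebra.lift ℂ C(K, ℂ) _ (characterFun K) with hF
  have hdense : DenseRange F := by
    intro f
    have h1 := characterFun_separates_adjoin_closure (Set.univ : Set (PontryaginDual K))
      (fun x y h => hK x y fun θ => h θ trivial)
    have h2 : f ∈ (StarAlgebra.adjoin ℂ (characterFun K '' Set.univ)).topologicalClosure :=
      h1 ▸ StarSubalgebra.mem_top
    refine closure_mono ?_ h2
    intro g hg
    rw [Set.image_univ] at hg
    obtain ⟨a, rfl⟩ := MonoidAlgebra.exists_lift_of_mem_adjoin _ star_characterFun hg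
    exact ⟨a, rfl⟩
  -- Trigonometric polynomials are dense, and by the norm comparison `S` factors through `F` and
  -- extends by continuity.
  let E : C(K, ℂ) →L[ℂ] D := S.toLinearMap.extendOfNorm F.toLinearMap
  have hE (a) : E (F a) = S a := LinearMap.extendOfNorm_eq (f := S.toLinearMap)
    (e := F.toLinearMap) hdense
    ⟨1, fun x => (norm_lift_le_norm_lift_characterFun σ x).trans_eq (one_mul _).symm⟩ a
  have hmul : ∀ x y, E (x * y) = E x * E y := by
    intro x y
    refine hdense.induction_on₂ (p := fun x y => E (x * y) = E x * E y)
      (isClosed_eq (by fun_prop) (by fun_prop)) (fun a b => ?_) x y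
    rw [← map_mul, hE, hE, hE, map_mul]
  have hone : E 1 = 1 := by rw [← map_one F, hE, map_one]
  have hstar : ∀ x, E (star x) = star (E x) := by
    intro x
    refine hdense.induction_on (p := fun x => E (star x) = star (E x)) x
      (isClosed_eq (by fun_prop) (by fun_prop)) (fun a => ?_)
    induction a using MonoidAlgebra.induction_linear with
    | zero => simp
    | add a b ha hb => rw [map_add, star_add, map_add, ha, hb, map_add, star_add]
    | single g c =>
      have h1 : star (F (MonoidAlgebra.single g c)) = F (MonoidAlgebra.single g⁻¹ (star c)) := by
        simp only [hF, MonoidAlgebra.lift_single, star_smul, star_characterFun]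
      rw [h1, hE, hE]
      simp [hS, ← Unitary.coe_star, Unitary.star_eq_inv]
  let E' : C(K, ℂ) →⋆ₐ[ℂ] D :=
    { toFun := E
      map_one' := hone
      map_mul' := hmul
      map_zero' := E.map_zero
      map_add' := E.map_add
      map_star' := hstar
      commutes' := fun r => by
        rw [Algebra.algebraMap_eq_smul_one, map_smul, hone, Algebra.algebraMap_eq_smul_one] }
  refine ⟨E', fun θ => ?_⟩
  change E (characterFun K θ) = _
  have h1 : characterFun K θ = F (MonoidAlgebra.single θ 1) := by simp [hF]
  rw [h1, hE]
  simp [hS]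

/-- The universal property of `C(𝕋)`. -/
theorem exists_starAlgHom_circleId {D : Type*} [CStarAlgebra D] (V : unitary D) :
    ∃ E : C(Circle, ℂ) →⋆ₐ[ℂ] D, E circleId = V := by
  have hV : IsStarNormal (V : D) := inferInstance
  -- The spectrum of a unitary lies on the circle: restrict functions to it, then apply the
  -- functional calculus.
  let r : C(spectrum ℂ (V : D), Circle) :=
    ⟨fun x => ⟨x, Unitary.spectrum_subset_circle V x.2⟩, by fun_prop⟩
  refine ⟨(cfcHom hV).comp (r.compStarAlgHom' ℂ ℂ), ?_⟩
  exact cfcHom_id hV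

/-! ### Extending unitary representations along cyclic extensions -/

/-- The diagonal embedding `x ↦ x ⊗ 1` of a C⋆-algebra into its matrices. -/
def CStarMatrix.scalarHom (ι D : Type*) [Fintype ι] [DecidableEq ι] [CStarAlgebra D] :
    D →⋆ₐ[ℂ] CStarMatrix ι ι D where
  toFun x := CStarMatrix.ofMatrix (Matrix.diagonal fun _ => x)
  map_one' := Matrix.diagonal_one
  map_mul' x y := (Matrix.diagonal_mul_diagonal (fun _ => x) (fun _ => y)).symm
  map_zero' := Matrix.diagonal_zero
  map_add' x y := (Matrix.diagonal_add (fun _ => x) (fun _ => y)).symm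
  commutes' _ := rfl
  map_star' x := (Matrix.diagonal_conjTranspose fun _ => x).symm

theorem CStarMatrix.scalarHom_apply {ι D : Type*} [Fintype ι] [DecidableEq ι] [CStarAlgebra D]
    (x : D) (i j : ι) : CStarMatrix.scalarHom ι D x i j = if i = j then x else 0 :=
  Matrix.diagonal_apply _ _ _

/-- The `k`-th power of the companion matrix of the polynomial `X ^ m - W`. -/
def companionPow {D : Type*} [CStarAlgebra D] (m : ℕ) (W : D) (k : ℕ) :
    CStarMatrix (Fin m) (Fin m) D :=
  CStarMatrix.ofMatrix fun i j => if (j + k : ℕ) % m = i then W ^ ((j + k : ℕ) / m) else 0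

theorem companionPow_apply {D : Type*} [CStarAlgebra D] (m : ℕ) (W : D) (k : ℕ) (i j : Fin m) :
    companionPow m W k i j = if (j + k : ℕ) % m = i then W ^ ((j + k : ℕ) / m) else 0 := rfl

/-- The matrix sends the basis vector e_j to W ^ q e_r, where j + k = q m + r with r < m. Under
composition the remainders combine modulo m and the quotients, carry included, add up. -/
theorem companionPow_mul {D : Type*} [CStarAlgebra D] (m : ℕ) (hm : 0 < m) (W : D) (k l : ℕ) :
    companionPow m W k * companionPow m W l = companionPow m W (k + l) := by
  ext i j
  rw [CStarMatrix.mul_apply, Finset.sum_eq_single ⟨(j + l : ℕ) % m, Nat.mod_lt _ hm⟩]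
  · simp only [companionPow_apply, if_true]
    have h1 : ((j + l : ℕ) % m + k) % m = (j + (k + l) : ℕ) % m := by
      rw [Nat.mod_add_mod]; congr 1; ring
    have h2 : ((j + l : ℕ) % m + k) / m + (j + l : ℕ) / m = (j + (k + l) : ℕ) / m := by
      have : (j + (k + l) : ℕ) = ((j + l : ℕ) % m + k) + m * ((j + l : ℕ) / m) := by
        have := Nat.mod_add_div (j + l : ℕ) m
        omega
      rw [this, Nat.add_mul_div_left _ _ hm]
    rw [h1, ite_mul, zero_mul, ← pow_add, h2]
  · intro b _ hb
    rw [companionPow_apply m W l, if_neg (fun h => hb (Fin.ext h.symm)), mul_zero]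
  · simp

theorem companionPow_zero {D : Type*} [CStarAlgebra D] (m : ℕ) (W : D) :
    companionPow m W 0 = 1 := by
  ext i j
  simp only [companionPow_apply, add_zero, Nat.mod_eq_of_lt j.2, Nat.div_eq_of_lt j.2, pow_zero,
    CStarMatrix.one_apply, Fin.ext_iff, eq_comm]

theorem companionPow_eq_pow {D : Type*} [CStarAlgebra D] (m : ℕ) (hm : 0 < m) (W : D) (k : ℕ) :
    companionPow m W 1 ^ k = companionPow m W k := by
  induction k with
  | zero => rw [pow_zero, companionPow_zero]
  | succ k ih => rw [pow_succ, ih, companionPow_mul m hm]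

theorem companionPow_self {D : Type*} [CStarAlgebra D] (m : ℕ) (hm : 0 < m) (W : D) :
    companionPow m W m = CStarMatrix.scalarHom (Fin m) D W := by
  ext i j
  simp only [companionPow_apply, CStarMatrix.scalarHom_apply, Nat.add_mod_right,
    Nat.mod_eq_of_lt j.2, Nat.add_div_right _ hm, Nat.div_eq_of_lt j.2, zero_add, pow_one,
    Fin.ext_iff, eq_comm]

/-- Each column has a single nonzero entry, 1 or the unitary W, and distinct columns have it in
distinct rows. -/
theorem star_companionPow_mul_self {D : Type*} [CStarAlgebra D] (m : ℕ) (hm : 0 < m)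
    (W : unitary D) : star (companionPow m (W : D) 1) * companionPow m (W : D) 1 = 1 := by
  ext i j
  rw [CStarMatrix.mul_apply, Finset.sum_eq_single ⟨(j + 1 : ℕ) % m, Nat.mod_lt _ hm⟩]
  · rw [CStarMatrix.star_apply, companionPow_apply, companionPow_apply, CStarMatrix.one_apply]
    simp only [if_true]
    have hij : (i + 1 : ℕ) % m = (j + 1 : ℕ) % m ↔ i = j := by
      refine ⟨fun h => ?_, fun h => by rw [h]⟩
      have := Nat.ModEq.add_right_cancel' 1 h
      rw [Nat.ModEq, Nat.mod_eq_of_lt i.2, Nat.mod_eq_of_lt j.2] at this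
      exact Fin.ext this
    by_cases h : i = j
    · subst h
      simp only [if_true, ← Unitary.coe_star, ← SubmonoidClass.coe_pow, ← Submonoid.coe_mul,
        Unitary.star_mul_self, Submonoid.coe_one]
    · rw [if_neg (fun h' => h (hij.1 h')), if_neg h, star_zero, zero_mul]
  · intro b _ hb
    rw [companionPow_apply m (W : D) 1 b j, if_neg (fun h => hb (Fin.ext h.symm)), mul_zero]
  · simp

theorem commute_scalarHom_companionPow {D : Type*} [CStarAlgebra D] (m : ℕ) {x W : D}
    (h : Commute x W) (k : ℕ) :
    Commute (CStarMatrix.scalarHom (Fin m) D x) (companionPow m W k) := by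
  ext i j
  rw [CStarMatrix.mul_apply, CStarMatrix.mul_apply, Finset.sum_eq_single i, Finset.sum_eq_single j]
  · simp only [CStarMatrix.scalarHom_apply, companionPow_apply, if_true, mul_ite, ite_mul, mul_zero,
      zero_mul, (h.pow_right _).eq]
  · intro b _ hb
    rw [CStarMatrix.scalarHom_apply, if_neg hb, mul_zero]
  · simp
  · intro b _ hb
    rw [CStarMatrix.scalarHom_apply, if_neg (Ne.symm hb), zero_mul]
  · simp

/-- A unitary has `m`-th roots in a larger C⋆-algebra, commuting with its commutant. -/
theorem exists_unitary_root (D : Type u) [CStarAlgebra D] [Nontrivial D] (m : ℕ) (hm : 0 < m)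
    (W : unitary D) :
    ∃ (D' : Type u) (_ : CStarAlgebra D') (_ : Nontrivial D') (i : D →⋆ₐ[ℂ] D') (V : unitary D'),
      Function.Injective i ∧ (V : D') ^ m = i W ∧ ∀ x : D, Commute x W → Commute (i x) V := by
  have : NeZero m := ⟨hm.ne'⟩
  -- The C⋆-norm on matrices over `D` comes from a Hilbert C⋆-module, which requires an order on
  -- `D`.
  let _ : PartialOrder D := CStarAlgebra.spectralOrder D
  have : StarOrderedRing D := CStarAlgebra.spectralOrderedRing D
  have hpow : companionPow m (W : D) 1 ^ m = CStarMatrix.scalarHom (Fin m) D W := by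
    rw [companionPow_eq_pow m hm, companionPow_self m hm]
  have hV : companionPow m (W : D) 1 ∈ unitary (CStarMatrix (Fin m) (Fin m) D) := by
    have h1 := star_companionPow_mul_self m hm W
    -- The m-th power is diagonal with unitary entry W, so the matrix is invertible and its left
    -- inverse, the adjoint, is two-sided.
    have h2 : IsUnit (companionPow m (W : D) 1) := by
      refine (isUnit_pow_iff hm.ne').1 ?_
      rw [hpow]
      exact (Unitary.toUnits W).isUnit.map _
    refine ⟨h1, ?_⟩
    obtain ⟨v, hv⟩ := h2
    rw [← hv] at h1 ⊢
    have h2 := Units.eq_inv_of_mul_eq_one_right h1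
    rw [h2, Units.mul_inv]
  refine ⟨CStarMatrix (Fin m) (Fin m) D, inferInstance, inferInstance,
    CStarMatrix.scalarHom (Fin m) D, ⟨_, hV⟩, fun x y h => ?_, hpow,
    fun x hx => commute_scalarHom_companionPow m hx 1⟩
  have := congrFun (congrFun h (0 : Fin m)) (0 : Fin m)
  simpa [CStarMatrix.scalarHom_apply] using this

/-- The map induced by a `*`-homomorphism on unitary groups. -/
def StarAlgHom.unitaryMap {A B : Type*} [CStarAlgebra A] [CStarAlgebra B] (i : A →⋆ₐ[ℂ] B) :
    unitary A →* unitary B where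
  toFun u := ⟨i u, Unitary.map_mem i u.2⟩
  map_one' := Subtype.ext (map_one i)
  map_mul' u v := Subtype.ext (map_mul i (u : A) v)

/-- A unitary representation of a group `H` extends, after enlarging the C⋆-algebra, to any
abelian group generated by `H` and one more element. -/
theorem exists_extension_unitaryRep {H B : Type*} [CommGroup H] [CommGroup B] (j : H →* B)
    (hj : Function.Injective j) (χ : B) (hχ : ∀ b : B, ∃ (h : H) (k : ℤ), j h * χ ^ k = b)
    (D : Type u) [CStarAlgebra D] [Nontrivial D] (ρ : H →* unitary D) :
    ∃ (D' : Type u) (_ : CStarAlgebra D') (_ : Nontrivial D') (i : D →⋆ₐ[ℂ] D')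
      (σ : B →* unitary D'), Function.Injective i ∧ ∀ h, (σ (j h) : D') = i (ρ h) := by
  -- V is to be the image of χ. The last condition says that (h, k) ↦ ρ(h) V ^ k respects every
  -- relation between H and χ, so that it descends to B.
  obtain ⟨D', _, _, i, V, hi, hcomm, hker⟩ : ∃ (D' : Type u) (_ : CStarAlgebra D')
      (_ : Nontrivial D') (i : D →⋆ₐ[ℂ] D') (V : unitary D'), Function.Injective i ∧
      (∀ h, Commute (i.unitaryMap (ρ h)) V) ∧
      ∀ h (k : ℤ), j h * χ ^ k = 1 → i.unitaryMap (ρ h) * V ^ k = 1 := by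
    -- If some positive power of χ lies in H, take the least, χ ^ m = h₀, and let V be an m-th root
    -- of ρ(h₀).
    by_cases hm : ∃ m : ℕ, 0 < m ∧ χ ^ m ∈ j.range
    · classical
      obtain ⟨hm0, h₀, hh₀⟩ := Nat.find_spec hm
      set m := Nat.find hm with hmdef
      obtain ⟨D', c1, c2, i, V, hi, hV, hcomm⟩ := exists_unitary_root D m hm0 (ρ h₀)
      have hVm : V ^ m = i.unitaryMap (ρ h₀) := Subtype.ext hV
      refine ⟨D', c1, c2, i, V, hi, fun h => ?_, fun h k hk => ?_⟩
      · refine Subtype.ext (hcomm _ ?_)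
        exact congrArg Subtype.val ((Commute.all h h₀).map ρ).eq
      -- Otherwise the remainder of k modulo m would be a smaller positive exponent with χ-power in
      -- H.
      · have hdvd : (m : ℤ) ∣ k := by
          by_contra hnd
          have hpos : 0 < k % m := lt_of_le_of_ne (Int.emod_nonneg _ (by omega))
            (fun h => hnd (Int.dvd_of_emod_eq_zero h.symm))
          have hlt : k % m < m := Int.emod_lt_of_pos _ (by omega)
          have hmem : χ ^ (k % (m : ℤ)) ∈ j.range := by
            have h1 : χ ^ k ∈ j.range :=
              MonoidHom.mem_range.2 ⟨h⁻¹, by rw [map_inv, inv_eq_of_mul_eq_one_right hk]⟩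
            have h2 : χ ^ (k % m) = χ ^ k * ((χ ^ m) ^ (k / m))⁻¹ := by
              rw [Int.emod_def, zpow_sub, zpow_mul, zpow_natCast]
            rw [h2]
            exact mul_mem h1 (inv_mem (zpow_mem (MonoidHom.mem_range.2 ⟨h₀, hh₀⟩) _))
          have hmin : ¬(0 < (k % m).toNat ∧ χ ^ (k % m).toNat ∈ j.range) :=
            Nat.find_min hm (by omega)
          refine hmin ⟨by omega, ?_⟩
          rwa [← zpow_natCast, Int.toNat_of_nonneg hpos.le]
        obtain ⟨q, rfl⟩ := hdvd
        have h1 : h * h₀ ^ q = 1 := hj (by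
          rw [map_mul, map_zpow, hh₀, map_one, ← zpow_natCast, ← zpow_mul, hk])
        rw [zpow_mul, zpow_natCast, hVm, ← map_zpow, ← map_zpow, ← map_mul, ← map_mul, h1, map_one,
          map_one]
    -- Here no nonzero power of χ lies in H, so there are no relations and V = 1 will do.
    · refine ⟨D, inferInstance, inferInstance, StarAlgHom.id ℂ D, 1, Function.injective_id,
        fun h => Commute.one_right _, fun h k hk => ?_⟩
      have hk0 : k = 0 := by
        by_contra hk0
        refine hm ⟨k.natAbs, Int.natAbs_pos.2 hk0, ?_⟩
        have h1 : χ ^ k ∈ j.range := ⟨h⁻¹, by rw [map_inv, inv_eq_of_mul_eq_one_right hk]⟩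
        rcases Int.natAbs_eq k with h' | h'
        · rwa [h', zpow_natCast] at h1
        · rw [h', zpow_neg, zpow_natCast] at h1
          exact inv_mem_iff.1 h1
      subst hk0
      have : h = 1 := hj (by simpa using hk)
      simp [this]
  have hw (h h' : H) (k k' : ℤ) (e : j h * χ ^ k = j h' * χ ^ k') :
      i.unitaryMap (ρ h) * V ^ k = i.unitaryMap (ρ h') * V ^ k' := by
    have h1 := hker (h'⁻¹ * h) (k - k') (by
      rw [map_mul, map_inv, zpow_sub]
      calc _ = (j h')⁻¹ * (j h * χ ^ k) * (χ ^ k')⁻¹ := by simp only [mul_assoc]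
        _ = 1 := by rw [e]; group)
    rw [map_mul, map_mul, map_inv, map_inv, zpow_sub] at h1
    have h2 : i.unitaryMap (ρ h) * V ^ k * (V ^ k')⁻¹ = i.unitaryMap (ρ h') := by
      rw [mul_assoc]
      rw [mul_assoc] at h1
      exact (inv_mul_eq_one.1 h1).symm
    rw [← h2, inv_mul_cancel_right]
  choose a k hak using hχ
  refine ⟨D', inferInstance, inferInstance, i,
    { toFun := fun b => i.unitaryMap (ρ (a b)) * V ^ k b
      map_one' := by
        rw [hw (a 1) 1 (k 1) 0 (by rw [hak]; simp)]
        simp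
      map_mul' := fun b c => by
        rw [hw (a (b * c)) (a b * a c) (k (b * c)) (k b + k c) (by
          rw [hak, map_mul, zpow_add, mul_mul_mul_comm, hak, hak])]
        rw [map_mul, map_mul, zpow_add, ((hcomm (a c)).zpow_right (k b)).mul_mul_mul_comm] },
    hi, fun h => ?_⟩
  have h1 := hw (a (j h)) h (k (j h)) 0 (by rw [hak]; simp)
  rw [zpow_zero, mul_one] at h1
  exact congrArg Subtype.val h1

/-! ### Simultaneous diagonalisation -/

theorem OrthogonalFamily.exists_orthonormalBasis {ι E : Type*} [NormedAddCommGroup E]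
    [InnerProductSpace ℂ E] [FiniteDimensional ℂ E] {V : ι → Submodule ℂ E}
    (hV : OrthogonalFamily ℂ (fun i => V i) fun i => (V i).subtypeₗᵢ) (htop : ⨆ i, V i = ⊤)
    {n : ℕ} (hn : Module.finrank ℂ E = n) :
    ∃ b : OrthonormalBasis (Fin n) ℂ E, ∀ k, ∃ i, b k ∈ V i := by
  let v (a : Σ i, Fin (Module.finrank ℂ (V i))) : E := stdOrthonormalBasis ℂ (V a.1) a.2
  have hv : Orthonormal ℂ v :=
    hV.orthonormal_sigma_orthonormal fun i => (stdOrthonormalBasis ℂ (V i)).orthonormal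
  -- The index type ι may be infinite, but orthonormal vectors are independent, so only finitely
  -- many summands contribute.
  have : Finite (Σ i, Fin (Module.finrank ℂ (V i))) := hv.linearIndependent.finite
  have := Fintype.ofFinite (Σ i, Fin (Module.finrank ℂ (V i)))
  have hspan : ⊤ ≤ Submodule.span ℂ (Set.range v) := by
    rw [← htop]
    refine iSup_le fun i => ?_
    have h1 : V i = (Submodule.span ℂ (Set.range (stdOrthonormalBasis ℂ (V i)))).map
        (V i).subtype := by
      rw [← OrthonormalBasis.coe_toBasis, Module.Basis.span_eq, Submodule.map_subtype_top]
    rw [h1, Submodule.map_span, Submodule.span_le]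
    rintro _ ⟨_, ⟨k, rfl⟩, rfl⟩
    exact Submodule.subset_span ⟨⟨i, k⟩, rfl⟩
  let b := OrthonormalBasis.mk hv hspan
  have hcard : Fintype.card (Σ i, Fin (Module.finrank ℂ (V i))) = n := by
    rw [← hn, Module.finrank_eq_card_basis b.toBasis]
  refine ⟨b.reindex (Fintype.equivFinOfCardEq hcard), fun k => ?_⟩
  rw [OrthonormalBasis.reindex_apply, OrthonormalBasis.coe_mk]
  exact ⟨_, Submodule.coe_mem _⟩

/-- Commuting normal matrices are simultaneously unitarily diagonalisable. -/
theorem Matrix.exists_unitary_diagonalization {ι : Type*} {n : ℕ}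
    (A : ι → Matrix (Fin n) (Fin n) ℂ) (h1 : ∀ i j, Commute (A i) (A j))
    (h2 : ∀ i j, Commute (A i) (star (A j))) :
    ∃ Q ∈ Matrix.unitaryGroup (Fin n) ℂ, ∃ χ : ι → Fin n → ℂ,
      ∀ i, A i = Q * Matrix.diagonal (χ i) * star Q := by
  have h3 (i j) : Commute (star (A i)) (star (A j)) := (h1 i j).star_star
  -- Up to scalars these are the real and imaginary parts of the A i: a commuting family of
  -- Hermitian matrices, to which the spectral theorem applies.
  let B : ι × Bool → Matrix (Fin n) (Fin n) ℂ := fun p =>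
    if p.2 then A p.1 + star (A p.1) else Complex.I • (A p.1 - star (A p.1))
  have hherm (p) : (B p).IsHermitian := by
    obtain ⟨i, _ | _⟩ := p
    · change star (Complex.I • (A i - star (A i))) = Complex.I • (A i - star (A i))
      rw [star_smul, star_sub, star_star, Complex.star_def, Complex.conj_I, neg_smul, ← smul_neg,
        neg_sub]
    · change star (A i + star (A i)) = A i + star (A i)
      rw [star_add, star_star, add_comm]
  have hcomm (p q) : Commute (B p) (B q) := by
    obtain ⟨i, _ | _⟩ := p <;> obtain ⟨j, _ | _⟩ := q <;>
    simp only [B, if_true, if_false, Bool.false_eq_true]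
    · exact (((h1 i j).sub_right (h2 i j)).sub_left
        ((h2 j i).symm.sub_right (h3 i j))).smul_left _ |>.smul_right _
    · exact (((h1 i j).add_right (h2 i j)).sub_left
        ((h2 j i).symm.add_right (h3 i j))).smul_left _
    · exact (((h1 i j).sub_right (h2 i j)).add_left
        ((h2 j i).symm.sub_right (h3 i j))).smul_right _
    · exact ((h1 i j).add_right (h2 i j)).add_left
        ((h2 j i).symm.add_right (h3 i j))
  let T (p) := (B p).toEuclideanLin
  have hT (p) : (T p).IsSymmetric := Matrix.isSymmetric_toEuclideanLin_iff.2 (hherm p)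
  have hTc : Pairwise (Function.onFun Commute T) := fun p q _ =>
    (hcomm p q).map (Matrix.toLpLinAlgEquiv (R := ℂ) (n := Fin n) 2)
  obtain ⟨b, hb⟩ := (LinearMap.IsSymmetric.orthogonalFamily_iInf_eigenspaces
    hT).exists_orthonormalBasis (LinearMap.IsSymmetric.iSup_iInf_eq_top_of_commute hT hTc)
    (finrank_euclideanSpace_fin (n := n))
  choose γ hγ using hb
  have hB (p) (k) : (B p).mulVec (b k).ofLp = γ k p • (b k).ofLp := by
    have h4 := (Submodule.mem_iInf _).1 (hγ k) p
    exact congrArg WithLp.ofLp (Module.End.mem_eigenspace_iff.1 h4)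
  let Q : Matrix (Fin n) (Fin n) ℂ := Matrix.of fun i k => b k i
  have hQ : star Q * Q = 1 := by
    ext k l
    have h5 := orthonormal_iff_ite.1 b.orthonormal k l
    rw [Matrix.one_apply, ← h5, Matrix.mul_apply, PiLp.inner_apply]
    refine Finset.sum_congr rfl fun i _ => ?_
    rw [RCLike.inner_apply, mul_comm]
    rfl
  have hQ' : Q * star Q = 1 := mul_eq_one_comm.1 hQ
  -- The eigenvalues of A = (1/2)((A + A*) - i · i(A - A*)).
  let χ (i : ι) (k : Fin n) : ℂ := (1 / 2) * (γ k (i, true) - Complex.I * γ k (i, false))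
  have hA (i) (k) : (A i).mulVec (b k).ofLp = χ i k • (b k).ofLp := by
    have h6 : A i = (1 / 2 : ℂ) • (B (i, true) - Complex.I • B (i, false)) := by
      simp only [B, if_true, if_false, Bool.false_eq_true, smul_smul, Complex.I_mul_I, neg_smul,
        one_smul, sub_neg_eq_add]
      rw [add_add_sub_cancel, ← two_smul ℂ, smul_smul]
      norm_num
    rw [h6, Matrix.smul_mulVec, Matrix.sub_mulVec, Matrix.smul_mulVec, hB, hB, smul_smul,
      ← sub_smul, smul_smul]
  refine ⟨Q, ⟨hQ, hQ'⟩, χ, fun i => ?_⟩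
  have h7 : A i * Q = Q * Matrix.diagonal (χ i) := by
    ext r k
    rw [Matrix.mul_diagonal]
    exact (congrFun (hA i k) r).trans (mul_comm _ _)
  rw [← h7, mul_assoc, hQ', mul_one]

/-! ### Topologically generated C⋆-algebras -/

theorem StarAlgHom.continuous_of_cstar {A B : Type*} [CStarAlgebra A] [CStarAlgebra B]
    (φ : A →⋆ₐ[ℂ] B) : Continuous φ :=
  AddMonoidHomClass.continuous_of_bound φ 1 fun x =>
    (NonUnitalStarAlgHom.norm_apply_le φ x).trans_eq (one_mul _).symm

/-- The generated algebra is closed in A, so the image of T in A is a closed subalgebra containing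
s. -/
theorem StarSubalgebra.eq_top_of_subset_of_isClosed {A : Type*} [CStarAlgebra A] (s : Set A)
    (T : StarSubalgebra ℂ (StarAlgebra.adjoin ℂ s).topologicalClosure)
    (hT : IsClosed (T : Set (StarAlgebra.adjoin ℂ s).topologicalClosure))
    (h : ∀ x (hx : x ∈ s), (⟨x, StarSubalgebra.le_topologicalClosure _
      (StarAlgebra.subset_adjoin ℂ _ hx)⟩ : (StarAlgebra.adjoin ℂ s).topologicalClosure) ∈ T) :
    T = ⊤ := by
  have hM := StarSubalgebra.isClosed_topologicalClosure (StarAlgebra.adjoin ℂ s)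
  have h1 : (StarAlgebra.adjoin ℂ s).topologicalClosure ≤ T.map (StarSubalgebra.subtype _) := by
    refine StarSubalgebra.topologicalClosure_minimal (StarAlgebra.adjoin_le fun x hx => ?_) ?_
    · exact ⟨_, h x hx, rfl⟩
    · rw [StarSubalgebra.coe_map]
      exact hM.isClosedEmbedding_subtypeVal.isClosedMap _ hT
  rw [StarSubalgebra.eq_top_iff]
  intro x
  obtain ⟨y, hy, hyx⟩ := h1 x.2
  rwa [← show y = x from Subtype.ext hyx]

theorem StarAlgHom.map_topologicalClosure_adjoin {A C : Type*} [CStarAlgebra A]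
    [CStarAlgebra C] (f : A →⋆ₐ[ℂ] C) (hf : Function.Injective f) (s : Set A) :
    (StarAlgebra.adjoin ℂ s).topologicalClosure.map f =
      (StarAlgebra.adjoin ℂ (f '' s)).topologicalClosure := by
  have hiso : Isometry f := NonUnitalStarAlgHom.isometry f hf
  apply le_antisymm
  · rintro _ ⟨x, hx, rfl⟩
    refine map_mem_closure hiso.continuous hx fun y hy => ?_
    have h1 : f y ∈ (StarAlgebra.adjoin ℂ s).map f := ⟨y, hy, rfl⟩
    rwa [StarAlgHom.map_adjoin] at h1
  · refine StarSubalgebra.topologicalClosure_minimal (StarAlgebra.adjoin_le ?_) ?_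
    · rintro _ ⟨x, hx, rfl⟩
      exact ⟨x, StarSubalgebra.le_topologicalClosure _ (StarAlgebra.subset_adjoin ℂ _ hx), rfl⟩
    · rw [StarSubalgebra.coe_map]
      exact hiso.isClosedEmbedding.isClosedMap _ (StarSubalgebra.isClosed_topologicalClosure _)

/-- Two C⋆-algebras embedded in a third one are isomorphic when they are generated by the same
elements. -/
theorem exists_starAlgEquiv_of_generators {ι A B C : Type*} [CStarAlgebra A] [CStarAlgebra B]
    [CStarAlgebra C] (f : A →⋆ₐ[ℂ] C) (g : B →⋆ₐ[ℂ] C) (hf : Function.Injective f)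
    (hg : Function.Injective g) (a : ι → A) (b : ι → B) (S : StarSubalgebra ℂ A)
    (hS : S = (StarAlgebra.adjoin ℂ (Set.range a)).topologicalClosure) (ha : ∀ k, a k ∈ S)
    (hb : (StarAlgebra.adjoin ℂ (Set.range b)).topologicalClosure = ⊤)
    (hab : ∀ k, f (a k) = g (b k)) : ∃ Φ : S ≃⋆ₐ[ℂ] B, ∀ k, Φ ⟨a k, ha k⟩ = b k := by
  -- Both images are the C⋆-algebra generated in C by the common elements f (a k) = g (b k).
  have hrange : S.map f = g.range := by
    rw [g.range_eq_map_top, ← hb, hS, f.map_topologicalClosure_adjoin hf,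
      g.map_topologicalClosure_adjoin hg, ← Set.range_comp, ← Set.range_comp]
    congr 3
    exact funext hab
  let e : S →⋆ₐ[ℂ] g.range := (f.comp S.subtype).codRestrict g.range
    fun x => hrange.le ⟨x, x.2, rfl⟩
  have he : Function.Bijective e := by
    refine ⟨fun x y h => Subtype.ext (hf (congrArg (fun z : g.range => (z : C)) h)), fun y => ?_⟩
    obtain ⟨x, hx, hxy⟩ := hrange.ge y.2
    exact ⟨⟨x, hx⟩, Subtype.ext hxy⟩
  refine ⟨(StarAlgEquiv.ofBijective e he).trans (StarAlgEquiv.ofInjective g hg).symm,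
    fun k => ?_⟩
  rw [StarAlgEquiv.trans_apply, StarAlgEquiv.symm_apply_eq]
  exact Subtype.ext (hab k)

/-! ### Evaluations of the universal C⋆-algebras -/

/-- Evaluation at an index of the `ℓ^∞`-product. -/
def lpInftyEval {I : Type*} {A : I → Type*} [∀ i, Nontrivial (A i)] [∀ i, CStarAlgebra (A i)]
    (i : I) : lp A ∞ →⋆ₐ[ℂ] A i where
  toFun x := x i
  map_one' := rfl
  map_mul' _ _ := rfl
  map_zero' := rfl
  map_add' _ _ := rfl
  commutes' _ := rfl
  map_star' _ := rfl

theorem groupCStar_eq_top_of_isClosed {Γ : Type u} [Group Γ] (T : StarSubalgebra ℂ (GroupCStar Γ))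
    (hT : IsClosed (T : Set (GroupCStar Γ))) (h : ∀ g, groupCStarOf Γ g ∈ T) : T = ⊤ := by
  refine StarSubalgebra.eq_top_of_subset_of_isClosed (Set.range (groupCStarGen (Γ := Γ))) T hT ?_
  rintro _ ⟨g, rfl⟩
  exact h g

theorem groupCStar_hom_ext {Γ : Type u} [Group Γ] {D : Type*} [CStarAlgebra D]
    (φ ψ : GroupCStar Γ →⋆ₐ[ℂ] D) (h : ∀ g, φ (groupCStarOf Γ g) = ψ (groupCStarOf Γ g)) :
    φ = ψ := by
  have h1 : StarAlgHom.equalizer φ ψ = ⊤ := groupCStar_eq_top_of_isClosed _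
    (isClosed_eq (StarAlgHom.continuous_of_cstar φ) (StarAlgHom.continuous_of_cstar ψ)) h
  ext x
  have : x ∈ StarAlgHom.equalizer φ ψ := h1 ▸ StarSubalgebra.mem_top
  exact this

/-- The representation of `C⋆(Γ)` given by a unitary representation of `Γ`. -/
def UnitaryRep.extend {Γ : Type u} [Group Γ] (ρ : UnitaryRep Γ) :
    GroupCStar Γ →⋆ₐ[ℂ] ρ.carrier :=
  (lpInftyEval ρ).comp (groupCStarSubalgebra Γ).subtype

theorem groupCStar_ext {Γ : Type u} [Group Γ] {x y : GroupCStar Γ}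
    (h : ∀ ρ : UnitaryRep Γ, ρ.extend x = ρ.extend y) : x = y :=
  Subtype.ext (lp.ext (funext h))

theorem UnitaryRep.norm_extend_le {Γ : Type u} [Group Γ] (ρ : UnitaryRep Γ) (x : GroupCStar Γ) :
    ‖ρ.extend x‖ ≤ ‖x‖ :=
  NonUnitalStarAlgHom.norm_apply_le ρ.extend x

/-! ### The embedding of `C⋆(ℤ * L̂)` into `C(𝕋) * C(K)` -/

/-- The identity function of the circle, as a unitary. -/
def circleUnitary : unitary C(Circle, ℂ) :=
  ⟨circleId, by
    constructor <;> ext x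
    · change (starRingEnd ℂ) (x : ℂ) * x = 1
      rw [← Circle.coe_inv_eq_conj, ← Circle.coe_mul, inv_mul_cancel, Circle.coe_one]
    · change (x : ℂ) * (starRingEnd ℂ) (x : ℂ) = 1
      rw [← Circle.coe_inv_eq_conj, ← Circle.coe_mul, mul_inv_cancel, Circle.coe_one]⟩

/-- The characters, as unitaries in the algebra of continuous functions. -/
def characterUnitary (K : Type*) [Group K] [TopologicalSpace K] [CompactSpace K] :
    PontryaginDual K →* unitary C(K, ℂ) where
  toFun θ := ⟨characterFun K θ, by
    rw [Unitary.mem_iff, star_characterFun, ← map_mul, ← map_mul, inv_mul_cancel, mul_inv_cancel,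
      map_one]
    exact ⟨rfl, rfl⟩⟩
  map_one' := Subtype.ext (map_one _)
  map_mul' θ η := Subtype.ext (map_mul (characterFun K) θ η)

section Embedding

variable {K : Type} [Group K] [TopologicalSpace K] [CompactSpace K] {H : Type} [CommGroup H]
  (j : H →* PontryaginDual K) (χ : PontryaginDual K)

/-- The representation of `ℤ * H` attached to a representation of `C(𝕋) * C(K)`: the generator
goes to `zχ`, and `h ∈ H` to the character `j h`. -/
def PairRep.toUnitaryRep (p : PairRep C(Circle, ℂ) C(K, ℂ)) :
    UnitaryRep (Monoid.Coprod (Multiplicative ℤ) H) where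
  carrier := p.carrier
  hom := Monoid.Coprod.lift
    (zpowersHom _ (p.left.unitaryMap circleUnitary * p.right.unitaryMap (characterUnitary K χ)))
    ((p.right.unitaryMap.comp (characterUnitary K)).comp j)

/-- The `*`-homomorphism from `C⋆(ℤ * H)` to the ambient algebra of `C(𝕋) * C(K)`. -/
def groupCStarToFreeProd : GroupCStar (Monoid.Coprod (Multiplicative ℤ) H) →⋆ₐ[ℂ]
    FreeProdAmbient C(Circle, ℂ) C(K, ℂ) where
  toFun x := ⟨fun p => (p.toUnitaryRep j χ).extend x, memℓp_infty ⟨‖x‖, by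
    rintro _ ⟨p, rfl⟩
    exact (p.toUnitaryRep j χ).norm_extend_le x⟩⟩
  map_one' := lp.ext (funext fun p => map_one (p.toUnitaryRep j χ).extend)
  map_mul' x y := lp.ext (funext fun p => map_mul (p.toUnitaryRep j χ).extend x y)
  map_zero' := lp.ext (funext fun p => map_zero (p.toUnitaryRep j χ).extend)
  map_add' x y := lp.ext (funext fun p => map_add (p.toUnitaryRep j χ).extend x y)
  commutes' r := lp.ext (funext fun p => AlgHomClass.commutes (p.toUnitaryRep j χ).extend r)
  map_star' x := lp.ext (funext fun p => map_star (p.toUnitaryRep j χ).extend x)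

theorem groupCStarToFreeProd_of (h : H) :
    groupCStarToFreeProd j χ (groupCStarOf _
      (Monoid.Coprod.inl (Multiplicative.ofAdd 1) * Monoid.Coprod.inr h)) =
    freeProdLeft circleId * freeProdRight (characterFun K (χ * j h)) := by
  refine lp.ext (funext fun p => ?_)
  change ((p.toUnitaryRep j χ).hom _ : (p.toUnitaryRep j χ).carrier) =
    p.left circleId * p.right (characterFun K (χ * j h))
  have h1 : (p.toUnitaryRep j χ).hom
      (Monoid.Coprod.inl (Multiplicative.ofAdd 1) * Monoid.Coprod.inr h) =
      p.left.unitaryMap circleUnitary * p.right.unitaryMap (characterUnitary K χ) *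
        p.right.unitaryMap (characterUnitary K (j h)) := by
    rw [map_mul]
    exact congrArg₂ (· * ·) (zpow_one _) rfl
  rw [h1, mul_assoc, ← map_mul, ← map_mul]
  rfl

/-- Elements of C⋆(ℤ * H) are separated by the representations ρ, so it suffices that each ρ,
followed by an injective `i`, occurs as a coordinate of the map. -/
theorem groupCStarToFreeProd_injective [IsTopologicalGroup K]
    (hK : ∀ x y : K, (∀ θ : PontryaginDual K, θ x = θ y) → x = y) (hj : Function.Injective j)
    (hχ : ∀ b : PontryaginDual K, ∃ (h : H) (k : ℤ), j h * χ ^ k = b) :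
    Function.Injective (groupCStarToFreeProd j χ) := by
  intro x y hxy
  refine groupCStar_ext fun ρ => ?_
  -- A representation of C(K) needs values at all characters, not only those from H.
  obtain ⟨D', _, _, i, σ, hi, hσ⟩ := exists_extension_unitaryRep j hj χ hχ ρ.carrier
    (ρ.hom.comp Monoid.Coprod.inr)
  obtain ⟨E, hE⟩ := exists_starAlgHom_characterFun hK σ
  -- The image of z is chosen so that zχ goes to the image of the generator of ℤ under ρ.
  obtain ⟨F, hF⟩ := exists_starAlgHom_circleId
    (i.unitaryMap (ρ.hom (Monoid.Coprod.inl (Multiplicative.ofAdd 1))) * (σ χ)⁻¹)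
  -- `D'` lies in the same universe as the carrier of ρ, so this pair is one of the indices of the
  -- product.
  let p : PairRep C(Circle, ℂ) C(K, ℂ) := { carrier := D', left := F, right := E }
  have hE' (θ) : E.unitaryMap (characterUnitary K θ) = σ θ := Subtype.ext (hE θ)
  have hF' : F.unitaryMap circleUnitary = _ := Subtype.ext hF
  have hp : (p.toUnitaryRep j χ).hom = i.unitaryMap.comp ρ.hom := by
    refine Monoid.Coprod.hom_ext (MonoidHom.ext_mint ?_) (MonoidHom.ext fun h => ?_)
    · change zpowersHom _ (F.unitaryMap circleUnitary * E.unitaryMap (characterUnitary K χ))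
        (Multiplicative.ofAdd 1) = _
      rw [hE', hF', inv_mul_cancel_right, zpowersHom_apply, toAdd_ofAdd, zpow_one]
      rfl
    · change E.unitaryMap (characterUnitary K (j h)) = _
      rw [hE']
      exact Subtype.ext (hσ h)
  have hext : (p.toUnitaryRep j χ).extend = i.comp ρ.extend :=
    groupCStar_hom_ext _ _ fun g => congrArg Subtype.val (DFunLike.congr_fun hp g)
  have h1 (x) : i (ρ.extend x) = groupCStarToFreeProd j χ x p :=
    (DFunLike.congr_fun hext x).symm
  exact hi (by rw [h1, h1, hxy])

end Embedding

/-! ### The fundamental matrix `w = Q diag(γ) Q*` -/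

/-- The matrix `Q diag(γ) Q*` over `ℂ[Γ]`, for a scalar matrix `Q` and group elements `γ`. -/
def groupMatrix {n : ℕ} {Γ : Type*} [Group Γ] (Q : Matrix (Fin n) (Fin n) ℂ) (γ : Fin n → Γ) :
    Matrix (Fin n) (Fin n) (MonoidAlgebra ℂ Γ) :=
  fun i j => ∑ p, MonoidAlgebra.single (γ p) (Q i p * star (Q j p))

theorem Matrix.unitaryGroup.sum_star_mul {n : ℕ} {Q : Matrix (Fin n) (Fin n) ℂ}
    (hQ : Q ∈ Matrix.unitaryGroup (Fin n) ℂ) (p q : Fin n) :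
    ∑ k, star (Q k p) * Q k q = if p = q then 1 else 0 := by
  have h := congrFun (congrFun hQ.1 p) q
  rwa [Matrix.mul_apply, Matrix.one_apply] at h

theorem Matrix.unitaryGroup.sum_mul_star {n : ℕ} {Q : Matrix (Fin n) (Fin n) ℂ}
    (hQ : Q ∈ Matrix.unitaryGroup (Fin n) ℂ) (i j : Fin n) :
    ∑ p, Q i p * star (Q j p) = if i = j then 1 else 0 := by
  have h := congrFun (congrFun hQ.2 i) j
  rwa [Matrix.mul_apply, Matrix.one_apply] at h

section groupMatrix

variable {n : ℕ} {Γ : Type} [Group Γ] {Q : Matrix (Fin n) (Fin n) ℂ} (γ : Fin n → Γ)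

theorem groupAlgebraToCStar_groupMatrix (i j : Fin n) :
    groupAlgebraToCStar Γ (groupMatrix Q γ i j) =
      ∑ p, (Q i p * star (Q j p)) • groupCStarOf Γ (γ p) := by
  simp only [groupMatrix, map_sum, groupAlgebraToCStar, MonoidAlgebra.lift_single]

theorem star_groupCStarOf (g : Γ) : star (groupCStarOf Γ g) = groupCStarOf Γ g⁻¹ := by
  refine Subtype.ext (lp.ext (funext fun π => ?_))
  change star ((π.hom g : unitary π.carrier) : π.carrier) = (π.hom g⁻¹ : unitary π.carrier)
  rw [map_inv, ← Unitary.star_eq_inv, Unitary.coe_star]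

theorem groupCStarOf_mem_unitary (g : Γ) : groupCStarOf Γ g ∈ unitary (GroupCStar Γ) := by
  rw [Unitary.mem_iff, star_groupCStarOf, ← map_mul, ← map_mul, inv_mul_cancel, mul_inv_cancel,
    map_one]
  exact ⟨rfl, rfl⟩

theorem groupMatrix_mem_unitary (hQ : Q ∈ Matrix.unitaryGroup (Fin n) ℂ) :
    (groupMatrix Q γ).map (groupAlgebraToCStar Γ) ∈
      unitary (Matrix (Fin n) (Fin n) (GroupCStar Γ)) := by
  let R : Matrix (Fin n) (Fin n) (GroupCStar Γ) := Q.map (algebraMap ℂ _)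
  have hstar : star R = (star Q).map (algebraMap ℂ (GroupCStar Γ)) := by
    ext1 i j
    exact (algebraMap_star_comm (R := ℂ) (A := GroupCStar Γ) (Q j i)).symm
  have hR : R ∈ unitary (Matrix (Fin n) (Fin n) (GroupCStar Γ)) := by
    rw [Unitary.mem_iff, hstar, ← Matrix.map_mul, ← Matrix.map_mul, hQ.1, hQ.2]
    simp
  have hD : Matrix.diagonal (fun p => groupCStarOf Γ (γ p)) ∈
      unitary (Matrix (Fin n) (Fin n) (GroupCStar Γ)) := by
    have h1 (p) := groupCStarOf_mem_unitary (γ p)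
    rw [Unitary.mem_iff, Matrix.star_eq_conjTranspose, Matrix.diagonal_conjTranspose,
      Matrix.diagonal_mul_diagonal, Matrix.diagonal_mul_diagonal]
    constructor <;> rw [← Matrix.diagonal_one] <;> congr 1 <;> ext1 p
    · exact (h1 p).1
    · exact (h1 p).2
  have h2 : (groupMatrix Q γ).map (groupAlgebraToCStar Γ) =
      R * Matrix.diagonal (fun p => groupCStarOf Γ (γ p)) * star R := by
    ext1 i j
    rw [Matrix.map_apply, groupAlgebraToCStar_groupMatrix, Matrix.mul_apply]
    refine Finset.sum_congr rfl fun p _ => ?_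
    have h3 : R i p = algebraMap ℂ _ (Q i p) := rfl
    rw [Matrix.mul_diagonal, hstar, Matrix.map_apply, h3, Matrix.star_apply,
      mul_smul, Algebra.smul_def, mul_assoc, ← Algebra.commutes, Algebra.smul_def]
  rw [h2]
  exact mul_mem (mul_mem hR hD) (Unitary.star_mem hR)

/-- Inverting the conjugation, diag(γ) = Q* w Q puts every γ_q in the span of the entries of w. -/
theorem groupMatrix_generates (hQ : Q ∈ Matrix.unitaryGroup (Fin n) ℂ)
    (hγ : Subgroup.closure (Set.range γ) = ⊤) :
    (StarAlgebra.adjoin ℂ {x | ∃ i j, x = groupAlgebraToCStar Γ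
      (groupMatrix Q γ i j)}).topologicalClosure = ⊤ := by
  set T := (StarAlgebra.adjoin ℂ {x | ∃ i j, x = groupAlgebraToCStar Γ
      (groupMatrix Q γ i j)}).topologicalClosure with hT
  have hw (i j) : groupAlgebraToCStar Γ (groupMatrix Q γ i j) ∈ T :=
    StarSubalgebra.le_topologicalClosure _ (StarAlgebra.subset_adjoin ℂ _ ⟨i, j, rfl⟩)
  have hmem (q : Fin n) : groupCStarOf Γ (γ q) ∈ T := by
    have h1 : groupCStarOf Γ (γ q) = ∑ i, ∑ j, (star (Q i q) * Q j q) •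
        groupAlgebraToCStar Γ (groupMatrix Q γ i j) := by
      have h2 (p : Fin n) : ∑ i, ∑ j, (star (Q i q) * Q j q) * (Q i p * star (Q j p)) =
          if q = p then 1 else 0 := by
        calc _ = ∑ i, ∑ j, (star (Q i q) * Q i p) * (star (Q j p) * Q j q) := by
              refine Finset.sum_congr rfl fun i _ => Finset.sum_congr rfl fun j _ => by ring
          _ = (∑ i, star (Q i q) * Q i p) * ∑ j, star (Q j p) * Q j q := by
              rw [Finset.sum_mul_sum]
          _ = _ := by
              rw [Matrix.unitaryGroup.sum_star_mul hQ, Matrix.unitaryGroup.sum_star_mul hQ]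
              by_cases h : q = p <;> simp [h]
      calc groupCStarOf Γ (γ q) =
            ∑ p, (if q = p then (1 : ℂ) else 0) • groupCStarOf Γ (γ p) := by simp
        _ = ∑ p, ∑ i, ∑ j, ((star (Q i q) * Q j q) * (Q i p * star (Q j p))) •
              groupCStarOf Γ (γ p) := by
            refine Finset.sum_congr rfl fun p _ => ?_
            rw [← h2, Finset.sum_smul]
            exact Finset.sum_congr rfl fun i _ => Finset.sum_smul
        _ = ∑ i, ∑ j, ∑ p, ((star (Q i q) * Q j q) * (Q i p * star (Q j p))) •
              groupCStarOf Γ (γ p) := by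
            rw [Finset.sum_comm]
            exact Finset.sum_congr rfl fun i _ => Finset.sum_comm
        _ = _ := by simp only [groupAlgebraToCStar_groupMatrix, Finset.smul_sum, smul_smul]
    rw [h1]
    exact sum_mem fun i _ => sum_mem fun j _ => SMulMemClass.smul_mem _ (hw i j)
  refine groupCStar_eq_top_of_isClosed T (StarSubalgebra.isClosed_topologicalClosure _) fun g => ?_
  have hg : g ∈ Subgroup.closure (Set.range γ) := hγ ▸ Subgroup.mem_top g
  induction hg using Subgroup.closure_induction with
  | mem x hx =>
    obtain ⟨q, rfl⟩ := hx
    exact hmem q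
  | one => rw [map_one]; exact one_mem T
  | mul x y _ _ hx hy => rw [map_mul]; exact mul_mem hx hy
  | inv x _ hx => rw [← star_groupCStarOf]; exact star_mem hx

/-- Write w = ∑ γ_p P_p, where P_p is the projection onto the p-th column of Q. The P_p are
self-adjoint, mutually orthogonal and sum to 1; with γ_p group-like this yields the antipode,
comultiplication and counit formulas. -/
theorem isFundamentalMatrix_groupMatrix (hQ : Q ∈ Matrix.unitaryGroup (Fin n) ℂ)
    (hγ : Subgroup.closure (Set.range γ) = ⊤) : IsFundamentalMatrix (groupMatrix Q γ) where
  unitary_mem := groupMatrix_mem_unitary γ hQ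
  generates := groupMatrix_generates γ hQ hγ
  comul i j := by
    have hs (p : Fin n) (c : ℂ) :
        (MonoidAlgebra.single (γ p) c : MonoidAlgebra ℂ Γ) = c • MonoidAlgebra.single (γ p) 1 := by
      simp
    have h1 (p q : Fin n) : ∑ k, (Q i p * star (Q k p)) * (Q k q * star (Q j q)) =
        if p = q then Q i p * star (Q j p) else 0 := by
      calc _ = Q i p * star (Q j q) * ∑ k, star (Q k p) * Q k q := by
            rw [Finset.mul_sum]
            exact Finset.sum_congr rfl fun k _ => by ring
        _ = _ := by
            rw [Matrix.unitaryGroup.sum_star_mul hQ]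
            by_cases h : p = q <;> simp [h]
    calc Coalgebra.comul (R := ℂ) (groupMatrix Q γ i j)
        = ∑ p, (Q i p * star (Q j p)) • ((MonoidAlgebra.single (γ p) 1 : MonoidAlgebra ℂ Γ) ⊗ₜ[ℂ]
            (MonoidAlgebra.single (γ p) 1 : MonoidAlgebra ℂ Γ)) := by
          rw [groupMatrix, map_sum]
          refine Finset.sum_congr rfl fun p _ => ?_
          rw [hs, map_smul, MonoidAlgebra.comul_single]
          simp
      _ = ∑ p, ∑ q, (∑ k, (Q i p * star (Q k p)) * (Q k q * star (Q j q))) •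
            ((MonoidAlgebra.single (γ p) 1 : MonoidAlgebra ℂ Γ) ⊗ₜ[ℂ]
            (MonoidAlgebra.single (γ q) 1 : MonoidAlgebra ℂ Γ)) := by
          refine Finset.sum_congr rfl fun p _ => ?_
          rw [Finset.sum_eq_single p, h1, if_pos rfl]
          · intro q _ hq
            rw [h1, if_neg (Ne.symm hq), zero_smul]
          · simp
      _ = ∑ p, ∑ q, ∑ k, ((Q i p * star (Q k p)) * (Q k q * star (Q j q))) •
            ((MonoidAlgebra.single (γ p) 1 : MonoidAlgebra ℂ Γ) ⊗ₜ[ℂ]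
            (MonoidAlgebra.single (γ q) 1 : MonoidAlgebra ℂ Γ)) := by
          simp only [Finset.sum_smul]
      _ = ∑ k, ∑ p, ∑ q, ((Q i p * star (Q k p)) * (Q k q * star (Q j q))) •
            ((MonoidAlgebra.single (γ p) 1 : MonoidAlgebra ℂ Γ) ⊗ₜ[ℂ]
            (MonoidAlgebra.single (γ q) 1 : MonoidAlgebra ℂ Γ)) := by
          rw [Finset.sum_comm (s := (Finset.univ : Finset (Fin n))) (f := fun k p => ∑ q,
            ((Q i p * star (Q k p)) * (Q k q * star (Q j q))) •
            ((MonoidAlgebra.single (γ p) 1 : MonoidAlgebra ℂ Γ) ⊗ₜ[ℂ]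
            (MonoidAlgebra.single (γ q) 1 : MonoidAlgebra ℂ Γ)))]
          refine Finset.sum_congr rfl fun p _ => ?_
          exact Finset.sum_comm
      _ = ∑ k, groupMatrix Q γ i k ⊗ₜ[ℂ] groupMatrix Q γ k j := by
          refine Finset.sum_congr rfl fun k _ => ?_
          simp only [groupMatrix, TensorProduct.sum_tmul]
          refine Finset.sum_congr rfl fun p _ => ?_
          rw [TensorProduct.tmul_sum]
          refine Finset.sum_congr rfl fun q _ => ?_
          rw [hs p (_ * _), hs q (_ * _), TensorProduct.smul_tmul_smul]
  counit i j := by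
    rw [groupMatrix, map_sum, ← Matrix.unitaryGroup.sum_mul_star hQ]
    refine Finset.sum_congr rfl fun p _ => ?_
    rw [MonoidAlgebra.counit_single]
    rfl
  antipode i j := by
    rw [groupAlgebraToCStar_groupMatrix, groupMatrix, map_sum, map_sum, star_sum]
    refine Finset.sum_congr rfl fun p _ => ?_
    rw [MonoidAlgebra.antipode_single, groupAlgebraToCStar, MonoidAlgebra.lift_single, star_smul,
      star_groupCStarOf, star_mul, star_star]
    rfl

end groupMatrix

/-! ### Characters of diagonalised groups -/

/-- The scalars are a continuous image of the circle. Closedness makes PU_n Hausdorff. -/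
theorem isClosed_scalarUnitary (n : ℕ) :
    IsClosed (scalarUnitary n : Set (Matrix.unitaryGroup (Fin n) ℂ)) := by
  let f (c : Circle) : Matrix.unitaryGroup (Fin n) ℂ := ⟨(c : ℂ) • 1, by
    rw [Unitary.mem_iff, star_smul, star_one, smul_mul_smul_comm, smul_mul_smul_comm, mul_one,
      Complex.star_def, ← Circle.coe_inv_eq_conj, ← Circle.coe_mul, ← Circle.coe_mul,
      inv_mul_cancel, mul_inv_cancel, Circle.coe_one, one_smul]
    exact ⟨rfl, rfl⟩⟩
  have hf : Continuous f := by
    refine Continuous.subtype_mk ?_ _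
    exact continuous_subtype_val.smul continuous_const
  have h : (scalarUnitary n : Set (Matrix.unitaryGroup (Fin n) ℂ)) = Set.range f := by
    ext g
    constructor
    · rintro ⟨c, hc⟩
      exact ⟨c, Subtype.ext hc.symm⟩
    · rintro ⟨c, rfl⟩
      exact ⟨c, rfl⟩
  rw [h]
  exact (isCompact_range hf).isClosed

/-- The projection of `G ⊆ U_n` onto its image in `PU_n`. -/
def projectiveProj {n : ℕ} (G : Subgroup (Matrix.unitaryGroup (Fin n) ℂ)) :
    G →ₜ* projectiveImage G where
  toMonoidHom := (QuotientGroup.mk' (scalarUnitary n)).subgroupMap G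
  continuous_toFun := (QuotientGroup.continuous_mk.comp continuous_subtype_val).subtype_mk _

theorem projectiveProj_surjective {n : ℕ} (G : Subgroup (Matrix.unitaryGroup (Fin n) ℂ)) :
    Function.Surjective (projectiveProj G) :=
  MonoidHom.subgroupMap_surjective _ _

theorem projectiveProj_eq_one_iff {n : ℕ} {G : Subgroup (Matrix.unitaryGroup (Fin n) ℂ)} (g : G) :
    projectiveProj G g = 1 ↔ (g : Matrix.unitaryGroup (Fin n) ℂ) ∈ scalarUnitary n :=
  Subtype.ext_iff.trans (QuotientGroup.eq_one_iff _)

/-- A continuous surjection from a compact space onto a Hausdorff one is closed. This lets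
characters of G that are trivial on scalars descend continuously to L. -/
theorem isQuotientMap_projectiveProj {n : ℕ} (G : Subgroup (Matrix.unitaryGroup (Fin n) ℂ))
    [CompactSpace G] : Topology.IsQuotientMap (projectiveProj G) := by
  have : IsClosed (scalarUnitary n : Set (Matrix.unitaryGroup (Fin n) ℂ)) :=
    isClosed_scalarUnitary n
  have : T2Space (ProjectiveUnitaryGroup n) := inferInstance
  exact (map_continuous (projectiveProj G)).isClosedMap.isQuotientMap
    (map_continuous (projectiveProj G)) (projectiveProj_surjective G)

theorem PontryaginDual.exists_of_isQuotientMap {G L : Type*} [Group G] [Group L]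
    [TopologicalSpace G] [TopologicalSpace L] (π : G →ₜ* L) (hπ : Topology.IsQuotientMap π)
    (θ : PontryaginDual G) (hθ : ∀ g, π g = 1 → θ g = 1) :
    ∃ η : PontryaginDual L, ∀ g, η (π g) = θ g := by
  let f : L →* Circle := π.toMonoidHom.liftOfRightInverse _
    (Function.rightInverse_surjInv hπ.surjective) ⟨(θ : G →* Circle), fun g hg => hθ g hg⟩
  have hf (g) : f (π g) = θ g := MonoidHom.liftOfRightInverse_comp_apply _ _ _ _ g
  have hcont : Continuous f := by
    rw [hπ.continuous_iff]
    exact (map_continuous θ).congr fun g => (hf g).symm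
  let η : L →ₜ* Circle := { f with continuous_toFun := hcont }
  exact ⟨η, hf⟩

/-- A group of unitary matrices diagonalised by `Q` has characters as diagonal coefficients. -/
theorem exists_characters_of_commute {n : ℕ} (G : Subgroup (Matrix.unitaryGroup (Fin n) ℂ))
    (hG : ∀ g ∈ G, ∀ h ∈ G, g * h = h * g) :
    ∃ Q ∈ Matrix.unitaryGroup (Fin n) ℂ, ∃ χ : Fin n → PontryaginDual G, ∀ g : G,
      ((g : Matrix.unitaryGroup (Fin n) ℂ) : Matrix (Fin n) (Fin n) ℂ) =
        Q * Matrix.diagonal (fun p => (χ p g : ℂ)) * star Q := by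
  let A (g : G) : Matrix (Fin n) (Fin n) ℂ := (g : Matrix.unitaryGroup (Fin n) ℂ)
  have hcomm (g h : G) : Commute (A g) (A h) := congrArg Subtype.val (hG g g.2 h h.2)
  have hstar (g : G) : star (A g) = A g⁻¹ := rfl
  obtain ⟨Q, hQ, χ, hχ⟩ := Matrix.exists_unitary_diagonalization A hcomm
    fun g h => hstar h ▸ hcomm g h⁻¹
  -- The diagonal is determined by g once Q is fixed, so multiplicativity, unitarity and continuity
  -- pass from g to its diagonal entries.
  have hdiag (g : G) : Matrix.diagonal (χ g) = star Q * A g * Q := by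
    rw [hχ g]
    calc Matrix.diagonal (χ g) = (star Q * Q) * Matrix.diagonal (χ g) * (star Q * Q) := by
          rw [hQ.1, one_mul, mul_one]
      _ = _ := by simp only [mul_assoc]
  have happly (g : G) (p) : χ g p = (star Q * A g * Q) p p := by
    rw [← hdiag, Matrix.diagonal_apply_eq]
  have hone (p) : χ 1 p = 1 := by
    have h1 : A 1 = 1 := rfl
    rw [happly, h1, mul_one, hQ.1, Matrix.one_apply_eq]
  have hmul (g h : G) (p) : χ (g * h) p = χ g p * χ h p := by
    have h1 : Matrix.diagonal (χ (g * h)) = Matrix.diagonal (χ g) * Matrix.diagonal (χ h) := by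
      have h2 : A (g * h) = A g * A h := rfl
      rw [hdiag, hdiag, hdiag, h2]
      calc _ = star Q * A g * 1 * A h * Q := by simp only [mul_assoc, mul_one]
        _ = _ := by rw [← hQ.2]; simp only [mul_assoc]
    rw [Matrix.diagonal_mul_diagonal] at h1
    exact congrFun (Matrix.diagonal_injective h1) p
  have hinv (g : G) (p) : χ g⁻¹ p = star (χ g p) := by
    have h1 : Matrix.diagonal (χ g⁻¹) = star (Matrix.diagonal (χ g)) := by
      rw [hdiag, hdiag, ← hstar, star_mul, star_mul, star_star, mul_assoc]
    rw [Matrix.star_eq_conjTranspose, Matrix.diagonal_conjTranspose] at h1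
    exact congrFun (Matrix.diagonal_injective h1) p
  have hnorm (g : G) (p) : ‖χ g p‖ = 1 := by
    have h1 : star (χ g p) * χ g p = 1 := by rw [← hinv, ← hmul, inv_mul_cancel, hone]
    have h2 : ‖χ g p‖ * ‖χ g p‖ = 1 := by
      rw [← norm_one (α := ℂ), ← h1, norm_mul, norm_star]
    nlinarith [norm_nonneg (χ g p)]
  have hcont (p) : Continuous fun g => χ g p := by
    simp only [happly]
    have hA : Continuous A := continuous_subtype_val.comp continuous_subtype_val
    exact ((continuous_const.mul hA).mul continuous_const).matrix_elem p p
  let θ (p : Fin n) : G →ₜ* Circle :=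
    { toFun := fun g => ⟨χ g p, mem_sphere_zero_iff_norm.2 (hnorm g p)⟩
      map_one' := Subtype.ext (hone p)
      map_mul' := fun g h => Subtype.ext (hmul g h p)
      continuous_toFun := (hcont p).subtype_mk _ }
  exact ⟨Q, hQ, θ, hχ⟩

theorem coordinateMatrix_eq_sum {n : ℕ} {G : Subgroup (Matrix.unitaryGroup (Fin n) ℂ)}
    {Q : Matrix (Fin n) (Fin n) ℂ} {χ : Fin n → PontryaginDual G}
    (hχ : ∀ g : G, ((g : Matrix.unitaryGroup (Fin n) ℂ) : Matrix (Fin n) (Fin n) ℂ) =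
      Q * Matrix.diagonal (fun p => (χ p g : ℂ)) * star Q) (i j : Fin n) :
    coordinateMatrix G i j = ∑ p, (Q i p * star (Q j p)) • characterFun G (χ p) := by
  ext g
  change ((g : Matrix.unitaryGroup (Fin n) ℂ) : Matrix (Fin n) (Fin n) ℂ) i j = _
  rw [hχ g, Matrix.mul_apply, ContinuousMap.coe_sum, Finset.sum_apply]
  refine Finset.sum_congr rfl fun p _ => ?_
  rw [Matrix.mul_diagonal, Matrix.star_apply, ContinuousMap.smul_apply, characterFun_apply,
    smul_eq_mul]
  ring

/-- Since η_o = 1, the generator a of ℤ is itself in the family, and then η_p = a⁻¹ (a η_p). -/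
theorem freeDual_closure_eq_top {H : Type*} [CommGroup H] {n : ℕ} (η : Fin n → H) (o : Fin n)
    (ho : η o = 1) (hη : Subgroup.closure (Set.range η) = ⊤) :
    Subgroup.closure (Set.range fun p => (Monoid.Coprod.inl (Multiplicative.ofAdd (1 : ℤ)) *
      Monoid.Coprod.inr (η p) : Monoid.Coprod (Multiplicative ℤ) H)) = ⊤ := by
  set S := Subgroup.closure (Set.range fun p => (Monoid.Coprod.inl (Multiplicative.ofAdd (1 : ℤ)) *
      Monoid.Coprod.inr (η p) : Monoid.Coprod (Multiplicative ℤ) H))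
  have hS (p) : (Monoid.Coprod.inl (Multiplicative.ofAdd (1 : ℤ)) *
      Monoid.Coprod.inr (η p) : Monoid.Coprod (Multiplicative ℤ) H) ∈ S :=
    Subgroup.subset_closure ⟨p, rfl⟩
  have ha : (Monoid.Coprod.inl (Multiplicative.ofAdd (1 : ℤ)) :
      Monoid.Coprod (Multiplicative ℤ) H) ∈ S := by simpa [ho] using hS o
  have hb (p) : (Monoid.Coprod.inr (η p) : Monoid.Coprod (Multiplicative ℤ) H) ∈ S := by
    simpa using mul_mem (inv_mem ha) (hS p)
  rw [eq_top_iff, ← Monoid.Coprod.range_inl_sup_range_inr]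
  refine sup_le ?_ ?_
  · rintro _ ⟨k, rfl⟩
    have h1 : (Monoid.Coprod.inl k : Monoid.Coprod (Multiplicative ℤ) H) =
        Monoid.Coprod.inl (Multiplicative.ofAdd (1 : ℤ)) ^ (Multiplicative.toAdd k) := by
      rw [← map_zpow, ← ofAdd_zsmul, smul_eq_mul, mul_one, ofAdd_toAdd]
    rw [h1]
    exact zpow_mem ha _
  · have h1 : Subgroup.closure (Set.range η) ≤ S.comap Monoid.Coprod.inr := by
      rw [Subgroup.closure_le]
      rintro _ ⟨p, rfl⟩
      exact hb p
    rintro _ ⟨x, rfl⟩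
    exact h1 (hη ▸ Subgroup.mem_top x)

/-- The embedding of the dual of the image of `G` in `PU_n` into the dual of `G`. -/
def projectiveDualMap {n : ℕ} (G : Subgroup (Matrix.unitaryGroup (Fin n) ℂ)) :
    PontryaginDual (projectiveImage G) →* PontryaginDual G :=
  (PontryaginDual.map (projectiveProj G)).toMonoidHom

theorem projectiveDualMap_injective {n : ℕ} (G : Subgroup (Matrix.unitaryGroup (Fin n) ℂ)) :
    Function.Injective (projectiveDualMap G) := fun θ θ' h => PontryaginDual.ext fun x => by
  obtain ⟨g, rfl⟩ := projectiveProj_surjective G x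
  exact DFunLike.congr_fun h g

/-- The characters of `G ⊆ U_n` on the diagonal, relative to one of them, are characters of the
image of `G` in `PU_n`, and these generate its dual. -/
theorem exists_projective_characters {n : ℕ} (G : Subgroup (Matrix.unitaryGroup (Fin n) ℂ))
    [CompactSpace G] (hG : ∀ g ∈ G, ∀ h ∈ G, g * h = h * g) (o : Fin n) :
    ∃ Q ∈ Matrix.unitaryGroup (Fin n) ℂ, ∃ χ : Fin n → PontryaginDual G,
      ∃ η : Fin n → PontryaginDual (projectiveImage G),
      (∀ g : G, ((g : Matrix.unitaryGroup (Fin n) ℂ) : Matrix (Fin n) (Fin n) ℂ) =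
        Q * Matrix.diagonal (fun p => (χ p g : ℂ)) * star Q) ∧
      (∀ p, χ o * projectiveDualMap G (η p) = χ p) ∧ η o = 1 ∧
      Subgroup.closure (Set.range χ) = ⊤ ∧ Subgroup.closure (Set.range η) = ⊤ := by
  obtain ⟨Q, hQ, χ, hχ⟩ := exists_characters_of_commute G hG
  have hπ := isQuotientMap_projectiveProj G
  have hsurj := projectiveProj_surjective G
  have : CompactSpace (projectiveImage G) := hsurj.compactSpace (map_continuous (projectiveProj G))
  -- Conjugation by Q fixes scalar matrices, so g is scalar exactly when its diagonal form is.
  have hscalar (g : G) : projectiveProj G g = 1 ↔ ∀ p, χ p g = χ o g := by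
    rw [projectiveProj_eq_one_iff]
    constructor
    · rintro ⟨c, hc⟩ p
      have h1 : Matrix.diagonal (fun p => (χ p g : ℂ)) = (c : ℂ) • 1 := by
        calc Matrix.diagonal (fun p => (χ p g : ℂ)) =
              (star Q * Q) * Matrix.diagonal (fun p => (χ p g : ℂ)) * (star Q * Q) := by
              rw [hQ.1, one_mul, mul_one]
          _ = star Q * (Q * Matrix.diagonal (fun p => (χ p g : ℂ)) * star Q) * Q := by
              simp only [mul_assoc]
          _ = _ := by rw [← hχ, hc, mul_smul_comm, mul_one, smul_mul_assoc, hQ.1]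
      have h2 (p) : (χ p g : ℂ) = c := by
        simpa using congrFun (congrFun h1 p) p
      exact Circle.ext ((h2 p).trans (h2 o).symm)
    · intro h
      refine ⟨χ o g, ?_⟩
      rw [hχ]
      simp only [h]
      rw [← Matrix.smul_one_eq_diagonal, mul_smul_comm, mul_one, smul_mul_assoc, hQ.2]
  have hex (p) := PontryaginDual.exists_of_isQuotientMap (projectiveProj G) hπ (χ p * (χ o)⁻¹)
    fun g hg => by
      rw [PontryaginDual.mul_apply, PontryaginDual.inv_apply, (hscalar g).1 hg p, mul_inv_cancel]
  choose η hη using hex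
  let j := projectiveDualMap G
  have hj : Function.Injective j := projectiveDualMap_injective G
  have hjη (p) : χ o * j (η p) = χ p := by
    have h1 : j (η p) = χ p * (χ o)⁻¹ := PontryaginDual.ext (hη p)
    rw [h1, mul_comm, inv_mul_cancel_right]
  have hηo : η o = 1 := hj (mul_left_cancel (a := χ o) (by rw [hjη, map_one, mul_one]))
  have hχsep (x y : G) (h : ∀ p, χ p x = χ p y) : x = y := by
    refine Subtype.ext (Subtype.ext ?_)
    rw [hχ, hχ]
    simp only [h]
  have hχtop : Subgroup.closure (Set.range χ) = ⊤ := dual_closure_eq_top_of_separates _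
    fun x y h => hχsep x y fun p => h _ ⟨p, rfl⟩
  -- If all η_p agree at x and y, a lift g of x y⁻¹ has χ_p(g) = χ_o(g) for every p; hence g is
  -- scalar and x = y.
  have hηtop : Subgroup.closure (Set.range η) = ⊤ := by
    refine dual_closure_eq_top_of_separates _ fun x y h => ?_
    obtain ⟨g, hg⟩ := hsurj (x * y⁻¹)
    rw [← mul_inv_eq_one, ← hg, hscalar]
    intro p
    have h1 : η p (x * y⁻¹) = 1 := by
      rw [map_mul, map_inv, h _ ⟨p, rfl⟩, mul_inv_cancel]
    rw [← hg, hη, PontryaginDual.mul_apply, PontryaginDual.inv_apply] at h1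
    exact mul_inv_eq_one.1 h1
  exact ⟨Q, hQ, χ, η, hχ, hjη, hηo, hχtop, hηtop⟩

/-! ### Matching the entries of ũ with those of w. -/

theorem freeProdLeft_mul_freeProdRight_sum {A B : Type u} [CStarAlgebra A] [CStarAlgebra B]
    {ι : Type*} (s : Finset ι) (a : A) (c : ι → ℂ) (b : ι → B) :
    freeProdLeft a * freeProdRight (∑ p ∈ s, c p • b p) =
      ∑ p ∈ s, c p • (freeProdLeft a * freeProdRight (b p) : FreeProdAmbient A B) := by
  refine lp.ext (funext fun π => ?_)
  change π.left a * π.right _ = lpInftyEval π _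
  rw [map_sum, map_sum, Finset.mul_sum]
  refine Finset.sum_congr rfl fun q _ => ?_
  rw [map_smul, map_smul, mul_smul_comm]
  rfl

theorem groupCStarToFreeProd_groupMatrix {K : Type} [Group K] [TopologicalSpace K] [CompactSpace K]
    {H : Type} [CommGroup H] (j : H →* PontryaginDual K) (χ : PontryaginDual K) {n : ℕ}
    (Q : Matrix (Fin n) (Fin n) ℂ) (η : Fin n → H) (i k : Fin n) :
    groupCStarToFreeProd j χ (groupAlgebraToCStar _ (groupMatrix Q (fun p =>
      Monoid.Coprod.inl (Multiplicative.ofAdd 1) * Monoid.Coprod.inr (η p)) i k)) =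
    freeProdLeft circleId * freeProdRight
      (∑ p, (Q i p * star (Q k p)) • characterFun K (χ * j (η p))) := by
  rw [groupAlgebraToCStar_groupMatrix, freeProdLeft_mul_freeProdRight_sum, map_sum]
  refine Finset.sum_congr rfl fun p _ => ?_
  rw [map_smul, groupCStarToFreeProd_of]

theorem freeProd_complexifiedMatrix_eq {n : ℕ} {G : Subgroup (Matrix.unitaryGroup (Fin n) ℂ)}
    [CompactSpace G] {Q : Matrix (Fin n) (Fin n) ℂ} {χ : Fin n → PontryaginDual G}
    {η : Fin n → PontryaginDual (projectiveImage G)}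
    (hχ : ∀ g : G, ((g : Matrix.unitaryGroup (Fin n) ℂ) : Matrix (Fin n) (Fin n) ℂ) =
      Q * Matrix.diagonal (fun p => (χ p g : ℂ)) * star Q) (o : Fin n)
    (hη : ∀ p, χ o * projectiveDualMap G (η p) = χ p) (i k : Fin n) :
    (freeProdSubalgebra C(Circle, ℂ) C(G, ℂ)).subtype
      (complexifiedMatrix (coordinateMatrix G) i k) =
      groupCStarToFreeProd (projectiveDualMap G) (χ o)
        (groupAlgebraToCStar (FreeDualGroup G) (groupMatrix Q (fun p =>
          Monoid.Coprod.inl (Multiplicative.ofAdd 1) * Monoid.Coprod.inr (η p)) i k)) := by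
  have h1 : coordinateMatrix G i k =
      ∑ p, (Q i p * star (Q k p)) • characterFun G (χ o * projectiveDualMap G (η p)) := by
    simp only [hη]
    exact coordinateMatrix_eq_sum hχ i k
  exact (congrArg (fun x => (freeProdLeft circleId * freeProdRight x :
    FreeProdAmbient C(Circle, ℂ) C(G, ℂ))) h1).trans
      (groupCStarToFreeProd_groupMatrix _ _ Q η i k).symm

theorem freeComplexification_eq {n : ℕ} {A : Type} [CStarAlgebra A]
    (u : Matrix (Fin n) (Fin n) A) : freeComplexification u = (StarAlgebra.adjoin ℂ
      (Set.range fun k : Fin n × Fin n => complexifiedMatrix u k.1 k.2)).topologicalClosure := by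
  have h : {x | ∃ i j, x = complexifiedMatrix u i j} =
      Set.range fun k : Fin n × Fin n => complexifiedMatrix u k.1 k.2 := by
    ext x
    simp [eq_comm]
  rw [freeComplexification, h]

theorem freeComplexification.exists_starAlgEquiv {n : ℕ} {A : Type} [CStarAlgebra A]
    (u : Matrix (Fin n) (Fin n) A) {B : Type*} [CStarAlgebra B]
    (g : B →⋆ₐ[ℂ] FreeProdAmbient C(Circle, ℂ) A) (hg : Function.Injective g)
    (b : Fin n → Fin n → B)
    (hb : (StarAlgebra.adjoin ℂ {x | ∃ i j, x = b i j}).topologicalClosure = ⊤)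
    (h : ∀ i j, (freeProdSubalgebra C(Circle, ℂ) A).subtype (complexifiedMatrix u i j) =
      g (b i j)) :
    ∃ Φ : freeComplexification u ≃⋆ₐ[ℂ] B, ∀ i j, Φ (complexifiedEntry u i j) = b i j := by
  have hb' : {x | ∃ i j, x = b i j} = Set.range fun k : Fin n × Fin n => b k.1 k.2 := by
    ext x
    simp [eq_comm]
  obtain ⟨Φ, hΦ⟩ := exists_starAlgEquiv_of_generators
    (freeProdSubalgebra C(Circle, ℂ) A).subtype g Subtype.val_injective hg
    (fun k : Fin n × Fin n => complexifiedMatrix u k.1 k.2) (fun k => b k.1 k.2)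
    (freeComplexification u) (freeComplexification_eq u)
    (fun k => (complexifiedEntry u k.1 k.2).2) (hb' ▸ hb) (fun k => h k.1 k.2)
  exact ⟨Φ, fun i j => hΦ (i, j)⟩

theorem exists_starAlgEquiv_freeComplexification {n : ℕ}
    {G : Subgroup (Matrix.unitaryGroup (Fin n) ℂ)}
    [CompactSpace G] {Q : Matrix (Fin n) (Fin n) ℂ}
    {χ : Fin n → PontryaginDual G} {η : Fin n → PontryaginDual (projectiveImage G)}
    (hχ : ∀ g : G, ((g : Matrix.unitaryGroup (Fin n) ℂ) : Matrix (Fin n) (Fin n) ℂ) =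
      Q * Matrix.diagonal (fun p => (χ p g : ℂ)) * star Q) (o : Fin n)
    (hη : ∀ p, χ o * projectiveDualMap G (η p) = χ p)
    (hχtop : Subgroup.closure (Set.range χ) = ⊤)
    (hgen : (StarAlgebra.adjoin ℂ {x | ∃ i k, x = groupAlgebraToCStar (FreeDualGroup G)
      (groupMatrix Q (fun p =>
        Monoid.Coprod.inl (Multiplicative.ofAdd 1) * Monoid.Coprod.inr (η p)) i k)}
      ).topologicalClosure = ⊤) :
    ∃ Φ : freeComplexification (coordinateMatrix G) ≃⋆ₐ[ℂ] GroupCStar (FreeDualGroup G),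
      ∀ i k, Φ (complexifiedEntry (coordinateMatrix G) i k) =
        groupAlgebraToCStar (FreeDualGroup G) (groupMatrix Q (fun p =>
          Monoid.Coprod.inl (Multiplicative.ofAdd 1) * Monoid.Coprod.inr (η p)) i k) := by
  -- Each generator χ_p = χ_o η_p of Ĝ lies in the product of L̂ and the powers of χ_o, so Ĝ is a
  -- cyclic extension of L̂.
  have hcyc (b : PontryaginDual G) : ∃ h k, projectiveDualMap G h * χ o ^ (k : ℤ) = b := by
    have h1 : Subgroup.closure (Set.range χ) ≤
        (projectiveDualMap G).range ⊔ Subgroup.zpowers (χ o) := by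
      rw [Subgroup.closure_le]
      rintro _ ⟨p, rfl⟩
      rw [← hη p, mul_comm]
      exact Subgroup.mul_mem_sup ⟨η p, rfl⟩ (Subgroup.mem_zpowers _)
    obtain ⟨_, ⟨h, rfl⟩, _, ⟨k, rfl⟩, hb⟩ := Subgroup.mem_sup.1 (h1 (hχtop ▸ Subgroup.mem_top b))
    exact ⟨h, k, hb⟩
  have hinj : Function.Injective (groupCStarToFreeProd (projectiveDualMap G) (χ o)) := by
    refine groupCStarToFreeProd_injective _ _ (fun x y h => ?_) (projectiveDualMap_injective G) hcyc
    refine Subtype.ext (Subtype.ext ?_)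
    rw [hχ, hχ]
    simp only [h]
  exact freeComplexification.exists_starAlgEquiv (coordinateMatrix G)
    (groupCStarToFreeProd (projectiveDualMap G) (χ o)) hinj
    (fun i k => groupAlgebraToCStar (FreeDualGroup G) (groupMatrix Q (fun p =>
      Monoid.Coprod.inl (Multiplicative.ofAdd 1) * Monoid.Coprod.inr (η p)) i k))
    hgen (freeProd_complexifiedMatrix_eq hχ o hη)

end

theorem theorem1p5 (n : ℕ) (hn : 1 ≤ n) (G : Subgroup (Matrix.unitaryGroup (Fin n) ℂ))
    [CompactSpace G] (hG : ∀ g ∈ G, ∀ h ∈ G, g * h = h * g) :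
    ∃ (w : Matrix (Fin n) (Fin n) (MonoidAlgebra ℂ (FreeDualGroup G)))
      (Φ : freeComplexification (coordinateMatrix G) ≃⋆ₐ[ℂ] GroupCStar (FreeDualGroup G)),
      IsFundamentalMatrix w ∧
      ∀ i j, Φ (complexifiedEntry (coordinateMatrix G) i j) =
        groupAlgebraToCStar (FreeDualGroup G) (w i j) := by
  -- The bound n ≥ 1 supplies the reference index o = 0.
  refine (exists_projective_characters G hG ⟨0, hn⟩).elim fun Q h => h.elim fun hQ h =>
    h.elim fun χ h => h.elim fun η h => ?_
  let γ (p : Fin n) : FreeDualGroup G :=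
    Monoid.Coprod.inl (Multiplicative.ofAdd 1) * Monoid.Coprod.inr (η p)
  have hw : IsFundamentalMatrix (groupMatrix Q γ) := isFundamentalMatrix_groupMatrix γ hQ
    (freeDual_closure_eq_top η _ h.2.2.1 h.2.2.2.2)
  refine Exists.intro (groupMatrix Q γ) ?_
  exact (exists_starAlgEquiv_freeComplexification h.1 _ h.2.1 h.2.2.2.1 hw.generates).elim
    fun Φ hΦ => Exists.intro Φ ⟨hw, hΦ⟩
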